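/- Let $\nu$ be a compactly supported Borel probability measure on the open unit disc $\mathbb{D}=\{w\in\mathbb{C}:|w|<1\}$ (that is, its topological support is a compact subset of $\mathbb{D}$), and let $\mu=\nu^{\mathbb{Z}}$ be the product measure on bi-infinite sequences $\omega=(\omega_n)_{n\in\mathbb{Z}}$ (it is carried by $\Omega=(\mathrm{supp}\,\nu)^{\mathbb{Z}}$). For $\omega\in\mathbb{D}^{\mathbb{Z}}$ put $\rho_n=(1-|\omega_n|^2)^{1/2}$, and let $\mathcal{E}_\omega$ be the extended CMV matrix with Verblunsky coefficients $(\omega_n)_{n\in\mathbb{Z}}$, i.e. the bounded operator on $\ell^2(\mathbb{Z})$ given, for $j\in\mathbb{Z}$, by $$(\mathcal{E}_\omega u)_{2j}=\bar\omega_{2j}\rho_{2j-1}u_{2j-1}-\bar\omega_{2j}\omega_{2j-1}u_{2j}+\bar\omega_{2j+1}\rho_{2j}u_{2j+1}+\rho_{2j+1}\rho_{2j}u_{2j+2},$$ $$(\mathcal{E}_\omega u)_{2j+1}=\rho_{2j}\rho_{2j-1}u_{2j-1}-\rho_{2j}\omega_{2j-1}u_{2j}-\bar\omega_{2j+1}\omega_{2j}u_{2j+1}-\rho_{2j+1}\omega_{2j}u_{2j+2}.$$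 Then there is a (unique) closed set $\Sigma_\mu\subset\partial\mathbb{D}$ such that $\sigma(\mathcal{E}_\omega)=\Sigma_\mu$ for $\mu$-almost every $\omega$, and the following holds. Let $(l_k)$ and $(r_k)$ be any two sequences of natural numbers with $l_k\to\infty$ and $r_k\to\infty$ as $k\to\infty$. Let $$A(\alpha,z)=\frac{1}{\sqrt{1-|\alpha|^2}}\begin{pmatrix} z&-\bar\alpha\\ -\alpha z&1\end{pmatrix},\qquad \Delta^{(k)}_\omega(z)=\mathrm{Tr}\bigl(A(\omega_{r_k},z)A(\omega_{r_k-1},z)\cdots A(\omega_{-l_k},z)\bigr),$$ and let $\mathcal{Z}^{(k)}_\omega=\{z\in\mathbb{C}:\Delta^{(k)}_\omega(z)=0\}$. Then for $\mu$-almost every $\omega$ we have $\mathcal{Z}^{(k)}_\omega\subset\partial\mathbb{D}$ for every $k$, and $$\lim_{k\to\infty}\mathrm{dist}_H\bigl(\mathcal{Z}^{(k)}_\omega,\Sigma_\mu\bigr)=0,$$ where $\mathrm{dist}_H$ is the Hausdorff distance. -/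

import Mathlib

open MeasureTheory Filter Topology
open scoped ComplexConjugate ENNReal

namespace CMV

/-- The open unit disc, with the topology and the Borel structure inherited from `ℂ`. -/
abbrev Disc : Type := Metric.ball (0 : ℂ) 1

/-- The Hilbert space `ℓ²(ℤ)` over `ℂ`. -/
abbrev H : Type := lp (fun _ : ℤ => ℂ) 2

/-- `ρ = (1 - |α|²)^{1/2}`. -/
noncomputable def rho (a : Disc) : ℝ := Real.sqrt (1 - ‖(a : ℂ)‖ ^ 2)

/-- The entry in row `n` and column `m` of the extended CMV matrix with Verblunsky coefficients
`ω`. The rows `2j` and `2j + 1` have their non-zero entries in the columns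
`2j - 1, 2j, 2j + 1, 2j + 2`. -/
noncomputable def entry (ω : ℤ → Disc) (n m : ℤ) : ℂ :=
  if Even n then
    if m = n - 1 then conj (ω n : ℂ) * (rho (ω (n - 1)) : ℂ)
    else if m = n then -(conj (ω n : ℂ) * (ω (n - 1) : ℂ))
    else if m = n + 1 then conj (ω (n + 1) : ℂ) * (rho (ω n) : ℂ)
    else if m = n + 2 then (rho (ω (n + 1)) : ℂ) * (rho (ω n) : ℂ)
    else 0
  else
    if m = n - 2 then (rho (ω (n - 1)) : ℂ) * (rho (ω (n - 2)) : ℂ)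
    else if m = n - 1 then -((rho (ω (n - 1)) : ℂ) * (ω (n - 2) : ℂ))
    else if m = n then -(conj (ω n : ℂ) * (ω (n - 1) : ℂ))
    else if m = n + 1 then -((rho (ω n) : ℂ) * (ω (n - 1) : ℂ))
    else 0

theorem norm_coe_le_one (a : Disc) : ‖(a : ℂ)‖ ≤ 1 :=
  (mem_ball_zero_iff.1 a.2).le

theorem norm_rho_le_one (a : Disc) : ‖(rho a : ℂ)‖ ≤ 1 := by
  rw [Complex.norm_real, Real.norm_eq_abs, rho, abs_of_nonneg (Real.sqrt_nonneg _)]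
  exact Real.sqrt_le_one.2 (by nlinarith [sq_nonneg ‖(a : ℂ)‖])

theorem norm_mul_le_one' {x y : ℂ} (hx : ‖x‖ ≤ 1) (hy : ‖y‖ ≤ 1) : ‖x * y‖ ≤ 1 := by
  rw [norm_mul]
  exact mul_le_one₀ hx (norm_nonneg _) hy

theorem norm_entry_le_one (ω : ℤ → Disc) (n m : ℤ) : ‖entry ω n m‖ ≤ 1 := by
  have hc : ∀ a : Disc, ‖conj (a : ℂ)‖ ≤ 1 := fun a => by
    rw [RCLike.norm_conj]; exact norm_coe_le_one a
  unfold entry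
  split_ifs <;>
    first
    | simp only [norm_zero, zero_le_one]
    | (try rw [norm_neg]
       exact norm_mul_le_one' (by first | exact hc _ | exact norm_rho_le_one _)
         (by first | exact norm_rho_le_one _ | exact norm_coe_le_one _))

theorem summable_norm_sq (u : H) : Summable fun n : ℤ => ‖u n‖ ^ (2 : ℝ≥0∞).toReal :=
  (lp.memℓp u).summable (by norm_num)

/-- The weighted shift `(W u)(n) = a(n) u(n + d)` on `ℓ²(ℤ)`, for weights with `|a(n)| ≤ 1`. -/
noncomputable def weightedShift (d : ℤ) (a : ℤ → ℂ) (ha : ∀ n, ‖a n‖ ≤ 1) : H →L[ℂ] H :=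
  have hle : ∀ (u : H) (n : ℤ), ‖a n * u (n + d)‖ ^ (2 : ℝ≥0∞).toReal ≤
      ‖u (n + d)‖ ^ (2 : ℝ≥0∞).toReal := fun u n => by
    refine Real.rpow_le_rpow (norm_nonneg _) ?_ (by norm_num)
    rw [norm_mul]
    exact mul_le_of_le_one_left (norm_nonneg _) (ha n)
  have hs : ∀ u : H, Summable fun n : ℤ => ‖u (n + d)‖ ^ (2 : ℝ≥0∞).toReal := fun u =>
    (Equiv.addRight d).summable_iff.2 (summable_norm_sq u)
  have hw : ∀ u : H, Summable fun n : ℤ => ‖a n * u (n + d)‖ ^ (2 : ℝ≥0∞).toReal := fun u =>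
    Summable.of_nonneg_of_le (fun _ => by positivity) (hle u) (hs u)
  LinearMap.mkContinuous
    { toFun := fun u => ⟨fun n => a n * u (n + d), memℓp_gen (hw u)⟩
      map_add' := fun u v => by
        ext n
        exact mul_add _ _ _
      map_smul' := fun c u => by
        ext n
        simp [mul_left_comm] }
    1
    (fun u => by
      refine lp.norm_le_of_tsum_le (by norm_num) (by positivity) ?_
      rw [one_mul, lp.norm_rpow_eq_tsum (by norm_num) u,
        ← (Equiv.addRight d).tsum_eq fun n : ℤ => ‖u n‖ ^ (2 : ℝ≥0∞).toReal]
      exact (hw u).tsum_le_tsum (hle u) (hs u))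

/-- The extended CMV matrix `𝓔_ω` as a bounded operator on `ℓ²(ℤ)`, written as the sum of its
five diagonals. -/
noncomputable def extendedCMV (ω : ℤ → Disc) : H →L[ℂ] H :=
  ∑ d ∈ Finset.Icc (-2 : ℤ) 2,
    weightedShift d (fun n => entry ω n (n + d)) (fun n => norm_entry_le_one ω n (n + d))

/-- `extendedCMV ω` acts on sequences as multiplication by the matrix with entries `entry ω`. -/
theorem extendedCMV_apply (ω : ℤ → Disc) (u : H) (n : ℤ) :
    extendedCMV ω u n = entry ω n (n - 2) * u (n - 2) + entry ω n (n - 1) * u (n - 1) +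
      entry ω n n * u n + entry ω n (n + 1) * u (n + 1) + entry ω n (n + 2) * u (n + 2) := by
  have h : Finset.Icc (-2 : ℤ) 2 = {-2, -1, 0, 1, 2} := by decide
  have hW : ∀ d : ℤ, (weightedShift d (fun n => entry ω n (n + d))
      (fun n => norm_entry_le_one ω n (n + d)) u) n = entry ω n (n + d) * u (n + d) :=
    fun _ => rfl
  have hS : extendedCMV ω u n =
      ∑ d ∈ Finset.Icc (-2 : ℤ) 2, entry ω n (n + d) * u (n + d) := by
    simp only [extendedCMV, _root_.sum_apply, lp.coeFn_sum, Finset.sum_apply, hW]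
  rw [hS, h]
  simp [sub_eq_add_neg, add_assoc]

/-- The one-step Szegő transfer matrix `A(α, z)`. -/
noncomputable def szego (a : Disc) (z : ℂ) : Matrix (Fin 2) (Fin 2) ℂ :=
  ((rho a : ℂ)⁻¹) • !![z, -conj (a : ℂ); -(a : ℂ) * z, 1]

/-- The discriminant over the window `[-l, r] ∩ ℤ`: the trace of the ordered product
`A(ω_r, z) A(ω_{r-1}, z) ⋯ A(ω_{-l}, z)`. -/
noncomputable def discriminant (ω : ℤ → Disc) (l r : ℕ) (z : ℂ) : ℂ :=
  (((List.range (l + r + 1)).map fun i => szego (ω ((r : ℤ) - (i : ℤ))) z).prod).trace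

/-- The set of all complex zeros of the discriminant over the window `[-l, r] ∩ ℤ`. -/
def discriminantZeros (ω : ℤ → Disc) (l r : ℕ) : Set ℂ :=
  {z : ℂ | discriminant ω l r z = 0}

end CMV

namespace CMV

open scoped Matrix

/-! The extended CMV matrix is a product of two block-diagonal unitaries (`act_eq_blockSum`), hence
unitary, so its spectrum consists of approximate eigenvalues and lies on the unit circle.

The candidate for the almost sure spectrum is explicit: `approxSpectrum ν.support`, where both the
finitely supported test vector and the coefficient sequence in the support may depend on the
tolerance. It contains the spectrum of every sequence with coefficients in the support. Conversely,
by the second Borel-Cantelli lemma almost every sequence imitates any prescribed finite pattern of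
the support after an even translation, and the translated test vector serves for it
(`ae_spectrum_eq`).

Let `T` be the transfer matrix over a window of length `n`. Since `det T = z ^ n`, Cayley-Hamilton
gives `T * T = tr T • T - z ^ n • 1`. Thus `tr T = 0` forces `T * T = -z ^ n • 1`, which is an
antiperiodic boundary condition over two copies of the window. Doubling also makes the period even,
so that the two-site blocks fit whatever the parity of `n`.

Each zero lies in `approxSpectrum`: for the periodized coefficients it yields a bounded,
non-decaying solution, and truncating that solution over many periods gives test vectors
(`discriminantZeros_subset_approxSpectrum`). Conversely, a test vector for `ω` supported inside the
window is equally good for the finite antiperiodic unitary matrix over two periods, so that matrix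
has an eigenvalue nearby; Cayley-Hamilton shows that its eigenvalues are zeros of the trace
(`exists_discriminantZero_near`). Compactness of the spectrum makes the second approximation
uniform. -/

theorem norm_coe_sq_lt_one (a : Disc) : ‖(a : ℂ)‖ ^ 2 < 1 := by
  have h := mem_ball_zero_iff.1 a.2
  nlinarith [norm_nonneg (a : ℂ)]

theorem rho_pos (a : Disc) : 0 < rho a :=
  Real.sqrt_pos.2 (by linarith [norm_coe_sq_lt_one a])

theorem rho_ne_zero (a : Disc) : (rho a : ℂ) ≠ 0 :=
  Complex.ofReal_ne_zero.2 (rho_pos a).ne'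

theorem rho_mul_self (a : Disc) : (rho a : ℂ) * rho a = 1 - (a : ℂ) * conj (a : ℂ) := by
  rw [← Complex.ofReal_mul, rho, Real.mul_self_sqrt (by linarith [norm_coe_sq_lt_one a]),
    Complex.mul_conj, Complex.normSq_eq_norm_sq]
  push_cast
  ring

/-! ### Factorization of the CMV matrix into two block-diagonal unitaries. -/

/-- Complex conjugation on the unit disc. -/
noncomputable def conjDisc (a : Disc) : Disc :=
  ⟨conj (a : ℂ), by
    rw [mem_ball_zero_iff, RCLike.norm_conj]
    exact mem_ball_zero_iff.1 a.2⟩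

@[simp] theorem coe_conjDisc (a : Disc) : (conjDisc a : ℂ) = conj (a : ℂ) := rfl

@[simp] theorem rho_conjDisc (a : Disc) : rho (conjDisc a) = rho a := by
  simp only [rho, coe_conjDisc, RCLike.norm_conj]

/-- The direct sum of the blocks `Θ(ω n)` acting on the coordinates `n, n + 1`, over all `n`
with `n + p` even, applied to an arbitrary sequence. -/
noncomputable def blockSum (p : ℤ) (ω : ℤ → Disc) (u : ℤ → ℂ) (n : ℤ) : ℂ :=
  if Even (n + p) then conj (ω n : ℂ) * u n + (rho (ω n) : ℂ) * u (n + 1)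
  else (rho (ω (n - 1)) : ℂ) * u (n - 1) - (ω (n - 1) : ℂ) * u n

theorem blockSum_of_even {p n : ℤ} (h : Even (n + p)) (ω : ℤ → Disc) (u : ℤ → ℂ) :
    blockSum p ω u n = conj (ω n : ℂ) * u n + (rho (ω n) : ℂ) * u (n + 1) :=
  if_pos h

theorem blockSum_add_one_of_even {p n : ℤ} (h : Even (n + p)) (ω : ℤ → Disc) (u : ℤ → ℂ) :
    blockSum p ω u (n + 1) = (rho (ω n) : ℂ) * u n - (ω n : ℂ) * u (n + 1) := by
  have h' : ¬Even (n + 1 + p) := by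
    rw [add_right_comm, Int.even_add_one]
    exact not_not.2 h
  rw [blockSum, if_neg h', add_sub_cancel_right]

/-- Every integer is the left or the right end of a block. -/
theorem even_or_exists_even (p n : ℤ) : Even (n + p) ∨ ∃ m, n = m + 1 ∧ Even (m + p) := by
  by_cases h : Even (n + p)
  · exact Or.inl h
  · refine Or.inr ⟨n - 1, by ring, ?_⟩
    rw [show n - 1 + p = n + p - 1 by ring, Int.even_sub_one]
    exact h

/-- Each block is a symmetric unitary matrix, so its inverse is its entrywise conjugate, which is
the block of the conjugate coefficient. -/
theorem blockSum_conj_blockSum (p : ℤ) (ω : ℤ → Disc) (u : ℤ → ℂ) :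
    blockSum p (fun n => conjDisc (ω n)) (blockSum p ω u) = u := by
  funext n
  obtain h | ⟨m, rfl, h⟩ := even_or_exists_even p n
  · rw [blockSum_of_even h, blockSum_of_even h, blockSum_add_one_of_even h]
    simp only [coe_conjDisc, rho_conjDisc, Complex.conj_conj]
    linear_combination u n * rho_mul_self (ω n)
  · rw [blockSum_add_one_of_even h, blockSum_of_even h, blockSum_add_one_of_even h]
    simp only [coe_conjDisc, rho_conjDisc]
    linear_combination u (m + 1) * rho_mul_self (ω m)

theorem blockSum_blockSum_conj (p : ℤ) (ω : ℤ → Disc) (u : ℤ → ℂ) :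
    blockSum p ω (blockSum p (fun n => conjDisc (ω n)) u) = u := by
  have h : (fun n => conjDisc (conjDisc (ω n))) = ω := by
    funext n
    exact Subtype.ext (Complex.conj_conj _)
  simpa only [h] using blockSum_conj_blockSum p (fun n => conjDisc (ω n)) u

theorem normSq_blockSum_add {p n : ℤ} (h : Even (n + p)) (ω : ℤ → Disc) (u : ℤ → ℂ) :
    ‖blockSum p ω u n‖ ^ 2 + ‖blockSum p ω u (n + 1)‖ ^ 2 = ‖u n‖ ^ 2 + ‖u (n + 1)‖ ^ 2 := by
  rw [blockSum_of_even h, blockSum_add_one_of_even h]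
  simp only [← Complex.normSq_eq_norm_sq]
  rw [← Complex.ofReal_inj]
  push_cast
  simp only [← Complex.mul_conj, map_add, map_sub, map_mul, Complex.conj_conj, Complex.conj_ofReal]
  linear_combination (u n * conj (u n) + u (n + 1) * conj (u (n + 1))) * rho_mul_self (ω n)

/-- The extended CMV matrix applied to an arbitrary sequence. -/
noncomputable def act (ω : ℤ → Disc) (u : ℤ → ℂ) (n : ℤ) : ℂ :=
  entry ω n (n - 2) * u (n - 2) + entry ω n (n - 1) * u (n - 1) +
      entry ω n n * u n + entry ω n (n + 1) * u (n + 1) + entry ω n (n + 2) * u (n + 2)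

/-- The inner factor couples the sites `2j - 1, 2j` and the outer one the sites `2j, 2j + 1`;
multiplying out gives the five diagonals. Unitarity and the transfer matrix formalism both rest on
this. -/
theorem act_eq_blockSum (ω : ℤ → Disc) (u : ℤ → ℂ) :
    act ω u = blockSum 0 ω (blockSum 1 ω u) := by
  funext n
  obtain h | ⟨m, rfl, h⟩ := even_or_exists_even 0 n
  · have h1 : Even (n - 1 + 1) := by simpa using h
    have h2 : Even (n + 1 + 1) := by
      rw [add_zero] at h
      exact (by simpa [add_assoc] using h.add even_two)
    rw [blockSum_of_even h, blockSum_of_even h2]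
    have h3 := blockSum_add_one_of_even h1 ω u
    rw [sub_add_cancel] at h3
    rw [h3]
    rw [add_zero] at h
    have e : n + 1 + 1 = n + 2 := by ring
    have c1 : n - 2 ≠ n - 1 := by omega
    have c2 : n - 2 ≠ n + 1 := by omega
    have c3 : n - 2 ≠ n + 2 := by omega
    have c4 : n - 2 ≠ n := by omega
    have c5 : n ≠ n - 1 := by omega
    have c6 : n + 1 ≠ n - 1 := by omega
    have c7 : n + 2 ≠ n - 1 := by omega
    simp only [act, entry, if_pos h, c1, c2, c3, c4, c5, c6, c7, if_true, if_false,
      add_eq_left, e, add_right_inj]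
    norm_num
    ring
  · have h1 : Even (m - 1 + 1) := by simpa using h
    have h2 : Even (m + 1 + 1) := by
      rw [add_zero] at h
      exact (by simpa [add_assoc] using h.add even_two)
    rw [blockSum_add_one_of_even h, blockSum_of_even h2]
    have h3 := blockSum_add_one_of_even h1 ω u
    rw [sub_add_cancel] at h3
    rw [h3]
    rw [add_zero] at h
    have hn : ¬Even (m + 1) := by
      rw [Int.even_add_one]
      exact not_not.2 h
    have e1 : m + 1 - 2 = m - 1 := by ring
    have e2 : m + 1 - 1 = m := by ring
    have e3 : m + 1 + 1 = m + 2 := by ring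
    have c1 : m ≠ m - 1 := by omega
    have c2 : m + 1 ≠ m - 1 := by omega
    have c3 : m + 2 ≠ m - 1 := by omega
    have c5 : m + 1 + 2 ≠ m - 1 := by omega
    have c6 : m + 1 + 2 ≠ m := by omega
    simp only [act, entry, if_neg hn, e1, e2, e3, c1, c2, c3, c5, c6, if_true, if_false,
      add_eq_left, add_right_inj]
    norm_num
    ring

theorem act_blockSum_conj (ω : ℤ → Disc) (u : ℤ → ℂ) :
    act ω (blockSum 1 (fun n => conjDisc (ω n)) (blockSum 0 (fun n => conjDisc (ω n)) u)) = u := by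
  rw [act_eq_blockSum, blockSum_blockSum_conj, blockSum_blockSum_conj]

/-! ### Spectrum and approximate eigenvectors of normal operators. -/

section NormalOperators

variable {E : Type*} [NormedAddCommGroup E] [InnerProductSpace ℂ E] [CompleteSpace E]

/-- A linear isometry of a Hilbert space onto itself is a unitary operator. -/
theorem mem_unitary_of_norm_map (T : E →L[ℂ] E) (h : ∀ x, ‖T x‖ = ‖x‖)
    (hs : Function.Surjective T) : T ∈ unitary (E →L[ℂ] E) := by
  have hi : Function.Injective T :=
    (AddMonoidHomClass.isometry_of_norm T h).injective
  exact IsUnit.mem_unitary_of_star_mul_self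
    (ContinuousLinearMap.isUnit_iff_bijective.2 ⟨hi, hs⟩)
    ((T.norm_map_iff_adjoint_comp_self).1 h)

/-- A spectral point of a normal operator is an approximate eigenvalue. -/
theorem exists_approx_eigenvector (T : E →L[ℂ] E) (hT : IsStarNormal T) {z : ℂ}
    (hz : z ∈ spectrum ℂ T) {ε : ℝ} (hε : 0 < ε) : ∃ x, ‖T x - z • x‖ < ε * ‖x‖ := by
  by_contra! h
  apply hz
  have hN : IsStarNormal (algebraMap ℂ (E →L[ℂ] E) z - T) := by
    refine ⟨?_⟩
    have h1 : Commute (star (algebraMap ℂ (E →L[ℂ] E) z)) (algebraMap ℂ (E →L[ℂ] E) z - T) := by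
      rw [← algebraMap_star_comm]
      exact Algebra.commutes _ _
    have h2 : Commute (star T) (algebraMap ℂ (E →L[ℂ] E) z - T) :=
      Commute.sub_right (Algebra.commutes z (star T)).symm hT.star_comm_self
    rw [star_sub]
    exact h1.sub_left h2
  have hanti : AntilipschitzWith ε.toNNReal⁻¹ (algebraMap ℂ (E →L[ℂ] E) z - T) := by
    refine ContinuousLinearMap.antilipschitz_of_bound _ fun x => ?_
    have := h x
    rw [NNReal.coe_inv, Real.coe_toNNReal _ hε.le, inv_mul_eq_div, le_div_iff₀ hε, mul_comm]
    rwa [sub_apply, ContinuousLinearMap.algebraMap_apply, norm_sub_rev]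
  rw [spectrum.mem_resolventSet_iff, ContinuousLinearMap.isUnit_iff_bijective,
    ContinuousLinearMap.bijective_iff_dense_range_and_antilipschitz]
  refine ⟨?_, _, hanti⟩
  rw [Submodule.topologicalClosure_eq_top_iff,
    ContinuousLinearMap.IsStarNormal.orthogonal_range hN, LinearMap.ker_eq_bot]
  exact hanti.injective

omit [CompleteSpace E] in
/-- An approximate eigenvalue is a spectral point. -/
theorem mem_spectrum_of_approx_eigenvector (T : E →L[ℂ] E) {z : ℂ}
    (h : ∀ ε > (0 : ℝ), ∃ x, ‖T x - z • x‖ < ε * ‖x‖) : z ∈ spectrum ℂ T := by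
  intro hu
  obtain ⟨u, hu⟩ := hu
  set R : E →L[ℂ] E := ((u⁻¹ : (E →L[ℂ] E)ˣ) : E →L[ℂ] E)
  have hR : ∀ x, ‖x‖ ≤ ‖R‖ * ‖T x - z • x‖ := fun x => by
    have h1 : R ((algebraMap ℂ (E →L[ℂ] E) z - T) x) = x := by
      rw [← hu, ← mul_apply_eq_comp, Units.inv_mul]
      rfl
    have h2 := R.le_opNorm ((algebraMap ℂ (E →L[ℂ] E) z - T) x)
    rw [h1] at h2
    rwa [sub_apply, ContinuousLinearMap.algebraMap_apply, norm_sub_rev] at h2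
  have hpos : 0 < ‖R‖ + 1 := by positivity
  obtain ⟨x, hx⟩ := h (‖R‖ + 1)⁻¹ (by positivity)
  have h3 := hR x
  rw [inv_mul_eq_div, lt_div_iff₀ hpos] at hx
  nlinarith [norm_nonneg (T x - z • x)]

/-- An approximate eigenvector of a normal operator detects spectrum nearby. -/
theorem exists_spectrum_near (T : E →L[ℂ] E) (hT : IsStarNormal T) (z : ℂ) {ε : ℝ} (hε : 0 < ε)
    {x : E} (hx : ‖T x - z • x‖ < ε * ‖x‖) : ∃ w ∈ spectrum ℂ T, dist w z < ε := by
  by_contra! h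
  have hne : ∀ w ∈ spectrum ℂ T, w - z ≠ 0 := fun w hw h0 => by
    have := h w hw
    rw [dist_eq_norm, h0, norm_zero] at this
    linarith
  have hc1 : ContinuousOn (fun w : ℂ => (w - z)⁻¹) (spectrum ℂ T) :=
    (continuousOn_id.sub continuousOn_const).inv₀ hne
  -- If the spectrum stays at distance `ε` from `z`, the functional calculus gives a resolvent of
  -- norm at most `ε⁻¹`, against the approximate eigenvector.
  have hb : ‖cfc (fun w : ℂ => (w - z)⁻¹) T‖ ≤ ε⁻¹ := by
    refine norm_cfc_le (by positivity) fun w hw => ?_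
    rw [norm_inv]
    refine inv_anti₀ hε ?_
    rw [← dist_eq_norm]
    exact h w hw
  have h1 : cfc (fun w : ℂ => (w - z)⁻¹) T * (T - algebraMap ℂ _ z) = 1 := by
    have h2 : cfc (fun w : ℂ => w - z) T = T - algebraMap ℂ _ z := by
      rw [cfc_sub (fun w : ℂ => w) (fun _ => z) T, cfc_id' ℂ T, cfc_const z T]
    rw [← h2, ← cfc_mul (fun w : ℂ => (w - z)⁻¹) (fun w : ℂ => w - z) T hc1]
    rw [← cfc_one ℂ T]
    exact cfc_congr fun w hw => inv_mul_cancel₀ (hne w hw)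
  have h3 : cfc (fun w : ℂ => (w - z)⁻¹) T (T x - z • x) = x := by
    have := congrArg (fun S : E →L[ℂ] E => S x) h1
    simpa [mul_apply_eq_comp, ContinuousLinearMap.algebraMap_apply] using this
  have h4 := (cfc (fun w : ℂ => (w - z)⁻¹) T).le_of_opNorm_le hb (T x - z • x)
  rw [h3, inv_mul_eq_div, le_div_iff₀ hε] at h4
  linarith

end NormalOperators

/-! ### Unitarity on `ℓ²(ℤ)`. -/

/-- The square of the `ℓ²` norm of a sequence, as an extended number. -/
noncomputable def energy (u : ℤ → ℂ) : ℝ≥0∞ := ∑' n, ENNReal.ofReal (‖u n‖ ^ 2)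

/-- With values in `ℝ≥0∞` the sum can be regrouped along the blocks of either parity without any
summability condition. -/
theorem energy_eq_tsum_pairs (p : ℤ) (u : ℤ → ℂ) :
    energy u = ∑' j : ℤ, ENNReal.ofReal (‖u (2 * j - p)‖ ^ 2 + ‖u (2 * j - p + 1)‖ ^ 2) := by
  rw [energy, ← (Equiv.subRight p).tsum_eq, ← (Int.divModEquiv 2).symm.tsum_eq, ENNReal.tsum_prod']
  refine tsum_congr fun j => ?_
  rw [tsum_fintype, Fin.sum_univ_two, ENNReal.ofReal_add (by positivity) (by positivity)]
  simp only [Int.divModEquiv_symm_apply, Equiv.subRight_apply]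
  simp only [Fin.coe_ofNat_eq_mod]
  norm_num
  simp only [mul_comm j 2, sub_add_eq_add_sub]

theorem energy_blockSum (p : ℤ) (ω : ℤ → Disc) (u : ℤ → ℂ) :
    energy (blockSum p ω u) = energy u := by
  rw [energy_eq_tsum_pairs p, energy_eq_tsum_pairs p u]
  refine tsum_congr fun j => ?_
  rw [normSq_blockSum_add (by simp)]

theorem energy_act (ω : ℤ → Disc) (u : ℤ → ℂ) : energy (act ω u) = energy u := by
  rw [act_eq_blockSum, energy_blockSum, energy_blockSum]

theorem energy_coe (u : H) : energy u = ENNReal.ofReal (‖u‖ ^ 2) := by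
  have h := lp.norm_rpow_eq_tsum (p := 2) (by norm_num) u
  have h2 := summable_norm_sq u
  simp only [ENNReal.toReal_ofNat, Real.rpow_two] at h h2
  rw [energy, h, ENNReal.ofReal_tsum_of_nonneg (fun n => by positivity) h2]

theorem memℓp_of_energy_ne_top {u : ℤ → ℂ} (h : energy u ≠ ∞) :
    Memℓp (E := fun _ : ℤ => ℂ) u 2 := by
  refine memℓp_gen ?_
  simp only [ENNReal.toReal_ofNat, Real.rpow_two]
  have := ENNReal.summable_toReal h
  simpa only [ENNReal.toReal_ofReal (sq_nonneg _)] using this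

theorem coe_extendedCMV (ω : ℤ → Disc) (u : H) : (extendedCMV ω u : ℤ → ℂ) = act ω u :=
  funext fun n => extendedCMV_apply ω u n

theorem norm_extendedCMV_apply (ω : ℤ → Disc) (u : H) : ‖extendedCMV ω u‖ = ‖u‖ := by
  have h := energy_act ω u
  rw [← coe_extendedCMV, energy_coe, energy_coe,
    ENNReal.ofReal_eq_ofReal_iff (by positivity) (by positivity)] at h
  exact (sq_eq_sq₀ (norm_nonneg _) (norm_nonneg _)).1 h

theorem surjective_extendedCMV (ω : ℤ → Disc) : Function.Surjective (extendedCMV ω) := by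
  intro w
  have hm : Memℓp (E := fun _ : ℤ => ℂ) (blockSum 1 (fun n => conjDisc (ω n))
      (blockSum 0 (fun n => conjDisc (ω n)) w)) 2 := by
    refine memℓp_of_energy_ne_top ?_
    rw [energy_blockSum, energy_blockSum, energy_coe]
    exact ENNReal.ofReal_ne_top
  refine ⟨⟨_, hm⟩, lp.ext ?_⟩
  rw [coe_extendedCMV]
  exact act_blockSum_conj ω w

theorem extendedCMV_mem_unitary (ω : ℤ → Disc) : extendedCMV ω ∈ unitary (H →L[ℂ] H) :=
  mem_unitary_of_norm_map _ (norm_extendedCMV_apply ω) (surjective_extendedCMV ω)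

theorem spectrum_extendedCMV_subset (ω : ℤ → Disc) :
    spectrum ℂ (extendedCMV ω) ⊆ Metric.sphere 0 1 :=
  spectrum.subset_circle_of_unitary (extendedCMV_mem_unitary ω)

theorem isStarNormal_of_mem_unitary {A : Type*} [Monoid A] [StarMul A] {a : A}
    (h : a ∈ unitary A) : IsStarNormal a :=
  ⟨by rw [Commute, SemiconjBy, Unitary.star_mul_self_of_mem h, Unitary.mul_star_self_of_mem h]⟩

/-! ### Finitely supported test vectors, translation and continuity in the coefficients. -/

/-- The sequence vanishes outside `[-L, L]`. -/
def SupportedIn (L : ℕ) (u : ℤ → ℂ) : Prop := ∀ n : ℤ, (L : ℤ) < |n| → u n = 0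

theorem exists_supported_near (u : H) {δ : ℝ} (hδ : 0 < δ) :
    ∃ (L : ℕ) (v : H), SupportedIn L v ∧ ‖v - u‖ < δ := by
  have h := lp.hasSum_single (p := 2) (by norm_num) u
  obtain ⟨s, hs⟩ := (Metric.tendsto_nhds.1 h δ hδ).exists
  refine ⟨s.sup Int.natAbs, _, fun n hn => ?_, by simpa [dist_eq_norm] using hs⟩
  rw [lp.coeFn_sum, Finset.sum_apply]
  refine Finset.sum_eq_zero fun i hi => lp.single_apply_ne 2 i _ ?_
  rintro rfl
  have := Finset.le_sup (f := Int.natAbs) hi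
  rw [Int.abs_eq_natAbs] at hn
  omega

/-- The strict inequality is an open condition on the vector, so it survives truncation to a large
finite window. -/
theorem exists_supported_approx_eigenvector (ω : ℤ → Disc) {z : ℂ}
    (hz : z ∈ spectrum ℂ (extendedCMV ω)) {ε : ℝ} (hε : 0 < ε) :
    ∃ (L : ℕ) (v : H), SupportedIn L v ∧ ‖extendedCMV ω v - z • v‖ < ε * ‖v‖ := by
  obtain ⟨x, hx⟩ := exists_approx_eigenvector (extendedCMV ω)
    (isStarNormal_of_mem_unitary (extendedCMV_mem_unitary ω)) hz hε
  have hc : IsOpen {v : H | ‖extendedCMV ω v - z • v‖ < ε * ‖v‖} :=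
    isOpen_lt (by fun_prop) (by fun_prop)
  obtain ⟨δ, hδ, hb⟩ := Metric.isOpen_iff.1 hc x hx
  obtain ⟨L, v, hv, hd⟩ := exists_supported_near x hδ
  exact ⟨L, v, hv, hb (by rwa [Metric.mem_ball, dist_eq_norm])⟩

theorem norm_eq_of_energy_eq {u v : H} (h : energy u = energy v) : ‖u‖ = ‖v‖ := by
  rw [energy_coe, energy_coe, ENNReal.ofReal_eq_ofReal_iff (by positivity) (by positivity)] at h
  exact (sq_eq_sq₀ (norm_nonneg _) (norm_nonneg _)).1 h

theorem energy_translate (d : ℤ) (u : ℤ → ℂ) : energy (fun n => u (n - d)) = energy u :=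
  (Equiv.subRight d).tsum_eq fun n => ENNReal.ofReal (‖u n‖ ^ 2)

/-- Translation by `d` on `ℓ²(ℤ)`. -/
noncomputable def translate (d : ℤ) (u : H) : H :=
  ⟨fun n => u (n - d), memℓp_of_energy_ne_top (by
    rw [energy_translate, energy_coe]
    exact ENNReal.ofReal_ne_top)⟩

/-- Even and odd rows have different shapes, so covariance is available under even shifts only. -/
theorem entry_translate {d : ℤ} (hd : Even d) (ω : ℤ → Disc) (n m : ℤ) :
    entry (fun i => ω (i + d)) (n - d) (m - d) = entry ω n m := by
  have e1 : n - d - 1 + d = n - 1 := by ring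
  have e2 : n - d + 1 + d = n + 1 := by ring
  have e3 : n - d - 2 + d = n - 2 := by ring
  have hE : Even (n - d) ↔ Even n := by simp [Int.even_sub, hd]
  have c1 : m - d = n - d - 1 ↔ m = n - 1 := by omega
  have c2 : m - d = n - d + 1 ↔ m = n + 1 := by omega
  have c3 : m - d = n - d - 2 ↔ m = n - 2 := by omega
  have c4 : m - d = n - d + 2 ↔ m = n + 2 := by omega
  have c5 : m - d = n - d ↔ m = n := by omega
  simp only [entry, hE, c1, c2, c3, c4, c5, e1, e2, e3, sub_add_cancel]

theorem act_translate {d : ℤ} (hd : Even d) (ω : ℤ → Disc) (u : ℤ → ℂ) (n : ℤ) :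
    act ω (fun i => u (i - d)) n = act (fun i => ω (i + d)) u (n - d) := by
  have e1 : n - 1 - d = n - d - 1 := by ring
  have e2 : n + 1 - d = n - d + 1 := by ring
  have e3 : n - 2 - d = n - d - 2 := by ring
  have e4 : n + 2 - d = n - d + 2 := by ring
  simp only [act, ← entry_translate hd ω n, e1, e2, e3, e4]

theorem norm_translate (d : ℤ) (u : H) : ‖translate d u‖ = ‖u‖ :=
  norm_eq_of_energy_eq (energy_translate d u)

theorem norm_extendedCMV_translate_sub {d : ℤ} (hd : Even d) (ω : ℤ → Disc) (u : H) (z : ℂ) :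
    ‖extendedCMV ω (translate d u) - z • translate d u‖ =
      ‖extendedCMV (fun i => ω (i + d)) u - z • u‖ := by
  have h : extendedCMV ω (translate d u) - z • translate d u =
      translate d (extendedCMV (fun i => ω (i + d)) u - z • u) := by
    refine lp.ext (funext fun n => ?_)
    have h1 := congrFun (coe_extendedCMV ω (translate d u)) n
    have h2 := congrFun (coe_extendedCMV (fun i => ω (i + d)) u) (n - d)
    change extendedCMV ω (translate d u) n - z * u (n - d) =
      extendedCMV (fun i => ω (i + d)) u (n - d) - z * u (n - d)
    rw [h1, h2, ← act_translate hd]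
    rfl
  rw [h, norm_translate]

theorem norm_sq_eq_sum {u : H} {s : Finset ℤ} (h : ∀ n ∉ s, u n = 0) :
    ‖u‖ ^ 2 = ∑ n ∈ s, ‖u n‖ ^ 2 := by
  have h1 := lp.norm_rpow_eq_tsum (p := 2) (by norm_num) u
  simp only [ENNReal.toReal_ofNat, Real.rpow_two] at h1
  rw [h1, tsum_eq_sum fun n hn => by rw [h n hn]; simp]

theorem act_eq_zero {L : ℕ} {u : ℤ → ℂ} (hu : SupportedIn L u) (ω : ℤ → Disc) {n : ℤ}
    (hn : (L : ℤ) + 2 < |n|) : act ω u n = 0 := by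
  have h : ∀ m : ℤ, |m - n| ≤ 2 → u m = 0 := fun m hm => hu m (by
    have := abs_sub_abs_le_abs_sub n m
    rw [abs_sub_comm] at this
    omega)
  rw [act, h (n - 2), h (n - 1), h n, h (n + 1), h (n + 2)]
  · simp
  all_goals norm_num

theorem norm_sq_extendedCMV_sub {L : ℕ} {v : H} (hv : SupportedIn L v) (ω : ℤ → Disc) (z : ℂ) :
    ‖extendedCMV ω v - z • v‖ ^ 2 =
      ∑ n ∈ Finset.Icc (-(L + 2) : ℤ) (L + 2), ‖act ω v n - z * v n‖ ^ 2 := by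
  have hc : ∀ n, (extendedCMV ω v - z • v : H) n = act ω v n - z * v n := fun n =>
    congrArg (· - z * v n) (congrFun (coe_extendedCMV ω v) n)
  simp only [← hc]
  refine norm_sq_eq_sum fun n hn => ?_
  have hn' : (L : ℤ) + 2 < |n| := by
    by_contra! h
    exact hn (Finset.mem_Icc.2 (abs_le.1 h))
  rw [hc, act_eq_zero hv ω hn', hv n (by omega), mul_zero, sub_zero]

theorem continuous_rho : Continuous rho := by
  unfold rho
  fun_prop

theorem continuous_entry (n m : ℤ) : Continuous fun ω : ℤ → Disc => entry ω n m := by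
  have h : ∀ i : ℤ, Continuous fun ω : ℤ → Disc => ((ω i : Disc) : ℂ) := fun i =>
    continuous_subtype_val.comp (continuous_apply i)
  have h' : ∀ i : ℤ, Continuous fun ω : ℤ → Disc => conj ((ω i : Disc) : ℂ) := fun i =>
    Complex.continuous_conj.comp (h i)
  have hr : ∀ i : ℤ, Continuous fun ω : ℤ → Disc => (rho (ω i) : ℂ) := fun i =>
    Complex.continuous_ofReal.comp (continuous_rho.comp (continuous_apply i))
  unfold entry
  split_ifs
  · exact (h' _).mul (hr _)
  · exact ((h' _).mul (h _)).neg
  · exact (h' _).mul (hr _)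
  · exact (hr _).mul (hr _)
  · exact continuous_const
  · exact (hr _).mul (hr _)
  · exact ((hr _).mul (h _)).neg
  · exact ((h' _).mul (h _)).neg
  · exact ((hr _).mul (h _)).neg
  · exact continuous_const

/-- For a finitely supported vector the residual involves finitely many coefficients, hence is
continuous in the product topology. -/
theorem isOpen_approx {L : ℕ} {v : H} (hv : SupportedIn L v) (z : ℂ) {ε : ℝ} (hε : 0 < ε) :
    IsOpen {ω : ℤ → Disc | ‖extendedCMV ω v - z • v‖ < ε * ‖v‖} := by
  have h : {ω : ℤ → Disc | ‖extendedCMV ω v - z • v‖ < ε * ‖v‖} =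
      {ω | ∑ n ∈ Finset.Icc (-(L + 2) : ℤ) (L + 2), ‖act ω v n - z * v n‖ ^ 2 <
        (ε * ‖v‖) ^ 2} := by
    ext ω
    rw [Set.mem_ofPred_eq, Set.mem_ofPred_eq, ← norm_sq_extendedCMV_sub hv]
    exact (sq_lt_sq₀ (norm_nonneg _) (by positivity)).symm
  rw [h]
  have hact : ∀ n, Continuous fun ω : ℤ → Disc => act ω v n := fun n => by
    have := continuous_entry n
    unfold act
    fun_prop
  refine isOpen_lt (continuous_finsetSum _ fun n _ => ?_) continuous_const
  exact ((hact n).sub continuous_const).norm.pow 2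

/-! ### The almost sure spectrum. -/

/-- The approximate eigenvalues, with finitely supported approximate eigenvectors, of the
extended CMV matrices with Verblunsky coefficients in `K`. -/
def approxSpectrum (K : Set Disc) : Set ℂ :=
  {z | ∀ ε > (0 : ℝ), ∃ η : ℤ → Disc, (∀ n, η n ∈ K) ∧ ∃ (L : ℕ) (v : H), SupportedIn L v ∧
    ‖extendedCMV η v - z • v‖ < ε * ‖v‖}

theorem spectrum_subset_approxSpectrum {K : Set Disc} {ω : ℤ → Disc} (h : ∀ n, ω n ∈ K) :
    spectrum ℂ (extendedCMV ω) ⊆ approxSpectrum K := fun _ hz _ hε =>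
  ⟨ω, h, exists_supported_approx_eigenvector ω hz hε⟩

/-- Almost every sequence visits a given open box around a sequence in the support, after an even
translation. -/
theorem ae_exists_translate_mem (ν : Measure Disc) [IsProbabilityMeasure ν] {U : Set (ℤ → Disc)}
    (hU : IsOpen U) {η : ℤ → Disc} (hη : ∀ n, η n ∈ ν.support) (hηU : η ∈ U) :
    ∀ᵐ ω ∂(Measure.infinitePi fun _ : ℤ => ν), ∃ d : ℤ, Even d ∧ (fun i => ω (i + d)) ∈ U := by
  obtain ⟨I, B, hB, hBU⟩ := isOpen_pi_iff.1 hU η hηU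
  -- All of `I` lies strictly between `-R` and `R`, so its translates by multiples of `2 * R` are
  -- disjoint and the events on them independent.
  set R : ℤ := I.sup Int.natAbs + 1 with hR
  have hIR : ∀ i ∈ I, |i| < R := fun i hi => by
    have := Finset.le_sup (f := Int.natAbs) hi
    rw [Int.abs_eq_natAbs]
    omega
  -- The representative of `j` modulo `2 * R` in `[-R, R)`; it recovers the original index from a
  -- translated one.
  set r : ℤ → ℤ := fun j => (j + R) % (2 * R) - R with hr
  have hri : ∀ i ∈ I, ∀ k : ℕ, r (i + 2 * R * k) = i := fun i hi k => by
    have h := abs_lt.1 (hIR i hi)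
    have : i + 2 * R * k + R = i + R + 2 * R * k := by ring
    simp only [hr, this, Int.add_mul_emod_self_left]
    rw [Int.emod_eq_of_lt (by omega) (by omega)]
    ring
  set J : ℕ → Finset ℤ := fun k => I.image fun i => i + 2 * R * k with hJ
  have hJd : ∀ k k', k ≠ k' → Disjoint (J k) (J k') := fun k k' hkk => by
    rw [Finset.disjoint_left]
    intro j hj hj'
    obtain ⟨i, hi, rfl⟩ := Finset.mem_image.1 hj
    obtain ⟨i', hi', he⟩ := Finset.mem_image.1 hj'
    have h1 := hri i hi k
    rw [← he, hri i' hi' k'] at h1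
    subst h1
    have h2 : 2 * R * (k' : ℤ) = 2 * R * k := by linarith
    have h3 : (2 * R : ℤ) ≠ 0 := by positivity
    exact hkk (by exact_mod_cast (mul_left_cancel₀ h3 h2).symm)
  have hm : ∀ k, ∀ j ∈ J k, MeasurableSet (B (r j)) := fun k j hj => by
    obtain ⟨i, hi, rfl⟩ := Finset.mem_image.1 hj
    rw [hri i hi k]
    exact (hB i hi).1.measurableSet
  set A : ℕ → Set (ℤ → Disc) := fun k => Set.pi (J k) fun j => B (r j) with hA
  have hAm : ∀ k, MeasurableSet (A k) := fun k =>
    MeasurableSet.pi (Finset.countable_toSet _) (hm k)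
  have hAμ : ∀ k, Measure.infinitePi (fun _ : ℤ => ν) (A k) = ∏ i ∈ I, ν (B i) := fun k => by
    rw [hA, Measure.infinitePi_pi _ (hm k), hJ,
      Finset.prod_image fun i _ i' _ h => add_right_cancel h]
    exact Finset.prod_congr rfl fun i hi => by rw [hri i hi k]
  have hind : ProbabilityTheory.iIndepSet A (Measure.infinitePi fun _ : ℤ => ν) := by
    rw [ProbabilityTheory.iIndepSet_iff_meas_biInter hAm]
    intro s
    have h1 : (⋂ k ∈ s, A k) = Set.pi (s.biUnion J : Finset ℤ) fun j => B (r j) := by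
      ext ω
      simp only [hA, Set.mem_iInter, Set.mem_pi, Finset.mem_coe, Finset.mem_biUnion]
      exact ⟨fun h j ⟨k, hk, hj⟩ => h k hk j hj, fun h k hk j hj => h j ⟨k, hk, hj⟩⟩
    rw [h1, Measure.infinitePi_pi, Finset.prod_biUnion fun k _ k' _ h => hJd k k' h]
    · exact Finset.prod_congr rfl fun k _ => (Measure.infinitePi_pi _ (hm k)).symm
    · intro j hj
      obtain ⟨k, -, hk⟩ := Finset.mem_biUnion.1 hj
      exact hm k j hk
  -- All the events have this same probability, positive because each `η i` is in the support; hence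
  -- the sum of probabilities diverges.
  have hp : (∏ i ∈ I, ν (B i)) ≠ 0 := Finset.prod_ne_zero_iff.2 fun i hi =>
    ((Measure.mem_support_iff_forall _).1 (hη i) _ ((hB i hi).1.mem_nhds (hB i hi).2)).ne'
  have hbc := ProbabilityTheory.measure_limsup_eq_one hAm hind (by
    simp only [hAμ]
    exact ENNReal.tsum_const_eq_top_of_ne_zero hp)
  have hae : limsup A atTop ∈ ae (Measure.infinitePi fun _ : ℤ => ν) :=
    (mem_ae_iff_prob_eq_one (MeasurableSet.measurableSet_limsup hAm)).2 hbc
  filter_upwards [hae] with ω hω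
  obtain ⟨k, hk⟩ := (mem_limsup_iff_frequently_mem.1 hω).exists
  refine ⟨2 * R * k, by simp [mul_assoc], hBU fun i hi => ?_⟩
  have : _ ∈ B (r _) := hk (i + 2 * R * k) (Finset.mem_coe.2 (Finset.mem_image_of_mem _ hi))
  rwa [hri i hi k] at this

/-- For each tolerance `1 / (k + 1)`, an even translate of the test vector works almost surely;
countably many tolerances suffice. -/
theorem ae_mem_spectrum (ν : Measure Disc) [IsProbabilityMeasure ν] {z : ℂ}
    (hz : z ∈ approxSpectrum ν.support) :
    ∀ᵐ ω ∂(Measure.infinitePi fun _ : ℤ => ν), z ∈ spectrum ℂ (extendedCMV ω) := by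
  have h : ∀ k : ℕ, ∀ᵐ ω ∂(Measure.infinitePi fun _ : ℤ => ν),
      ∃ x, ‖extendedCMV ω x - z • x‖ < 1 / ((k : ℝ) + 1) * ‖x‖ := fun k => by
    have hk : (0 : ℝ) < 1 / ((k : ℝ) + 1) := by positivity
    obtain ⟨η, hη, L, v, hv, hlt⟩ := hz _ hk
    filter_upwards [ae_exists_translate_mem ν (isOpen_approx hv z hk) hη hlt] with ω hω
    obtain ⟨d, hd, hω⟩ := hω
    refine ⟨translate d v, ?_⟩
    rw [norm_extendedCMV_translate_sub hd, norm_translate]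
    exact hω
  filter_upwards [ae_all_iff.2 h] with ω hω
  refine mem_spectrum_of_approx_eigenvector _ fun ε hε => ?_
  obtain ⟨k, hk⟩ := exists_nat_one_div_lt hε
  obtain ⟨x, hx⟩ := hω k
  exact ⟨x, hx.trans_le (by gcongr)⟩

theorem ae_mem_support (ν : Measure Disc) [IsProbabilityMeasure ν] :
    ∀ᵐ ω ∂(Measure.infinitePi fun _ : ℤ => ν), ∀ n, ω n ∈ ν.support := by
  rw [ae_all_iff]
  intro n
  have h := (measurePreserving_eval_infinitePi (fun _ : ℤ => ν) n).quasiMeasurePreserving.ae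
    (p := fun a => a ∈ ν.support) ν.support_mem_ae
  exact h

/-- The almost sure spectrum is the set of approximate eigenvalues over the support. -/
theorem ae_spectrum_eq (ν : Measure Disc) [IsProbabilityMeasure ν] :
    ∀ᵐ ω ∂(Measure.infinitePi fun _ : ℤ => ν),
      spectrum ℂ (extendedCMV ω) = approxSpectrum ν.support := by
  -- The exceptional null set depends on `z`; a countable dense set of `z` is enough because the
  -- spectrum is closed.
  obtain ⟨D, hD, hDc, hDd⟩ := (TopologicalSpace.IsSeparable.of_separableSpace
    (approxSpectrum ν.support)).exists_countable_dense_subset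
  have h : ∀ᵐ ω ∂(Measure.infinitePi fun _ : ℤ => ν), ∀ z ∈ D, z ∈ spectrum ℂ (extendedCMV ω) :=
    (ae_ball_iff hDc).2 fun z hz => ae_mem_spectrum ν (hD hz)
  filter_upwards [h, ae_mem_support ν] with ω h1 h2
  refine (spectrum_subset_approxSpectrum h2).antisymm (hDd.trans ?_)
  exact closure_minimal h1 (spectrum.isClosed _)

/-! ### Transfer matrices and the Szegő cocycle. -/

/-- The transfer matrix `A(ω_{m+k-1}, z) ⋯ A(ω_m, z)`. -/
noncomputable def transfer (ω : ℤ → Disc) (z : ℂ) (m : ℤ) : ℕ → Matrix (Fin 2) (Fin 2) ℂ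
  | 0 => 1
  | k + 1 => szego (ω (m + k)) z * transfer ω z m k

theorem prod_szego_eq_transfer (ω : ℤ → Disc) (z : ℂ) (m : ℤ) (k : ℕ) :
    ((List.range k).map fun i : ℕ => szego (ω (m + k - 1 - (i : ℤ))) z).prod = transfer ω z m k := by
  induction k with
  | zero => simp [transfer]
  | succ k ih =>
    rw [List.range_succ_eq_map, List.map_cons, List.prod_cons, List.map_map, transfer, ← ih]
    congr 2
    · congr 2
      push_cast
      ring
    · refine List.map_congr_left fun i _ => ?_
      simp only [Function.comp_apply]
      congr 2
      push_cast
      ring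

theorem discriminant_eq (ω : ℤ → Disc) (l r : ℕ) (z : ℂ) :
    discriminant ω l r z = (transfer ω z (-l) (l + r + 1)).trace := by
  rw [discriminant, ← prod_szego_eq_transfer]
  simp only [List.pure_def, List.bind_eq_flatMap, ← List.map_eq_flatMap, List.map_map]
  congr 2
  refine List.map_congr_left fun i _ => ?_
  simp only [Function.comp_apply]
  congr 2
  push_cast
  ring

theorem transfer_add (ω : ℤ → Disc) (z : ℂ) (m : ℤ) (j k : ℕ) :
    transfer ω z m (j + k) = transfer ω z (m + j) k * transfer ω z m j := by
  induction k with
  | zero => simp [transfer]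
  | succ k ih =>
    rw [← add_assoc, transfer, ih, transfer, Matrix.mul_assoc]
    congr 3
    push_cast
    ring

theorem transfer_congr {ω η : ℤ → Disc} {m m' : ℤ} {k : ℕ}
    (h : ∀ i < k, ω (m + i) = η (m' + i)) (z : ℂ) : transfer ω z m k = transfer η z m' k := by
  induction k with
  | zero => rfl
  | succ k ih => rw [transfer, transfer, ih fun i hi => h i (by omega), h k (by omega)]

theorem det_szego (a : Disc) (z : ℂ) : (szego a z).det = z := by
  have h1 := rho_ne_zero a
  rw [szego, Matrix.det_smul, Matrix.det_fin_two_of, Fintype.card_fin]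
  field_simp
  linear_combination -z * rho_mul_self a

theorem det_transfer (ω : ℤ → Disc) (z : ℂ) (m : ℤ) (k : ℕ) :
    (transfer ω z m k).det = z ^ k := by
  induction k with
  | zero => simp [transfer]
  | succ k ih => rw [transfer, Matrix.det_mul, det_szego, ih, pow_succ']

/-- Cayley-Hamilton: it converts a vanishing trace into a scalar square, and back. -/
theorem mul_self_fin_two (T : Matrix (Fin 2) (Fin 2) ℂ) : T * T = T.trace • T - T.det • 1 := by
  rw [Matrix.trace_fin_two, Matrix.det_fin_two]
  ext i j
  fin_cases i <;> fin_cases j <;> simp [Matrix.mul_apply, Fin.sum_univ_two] <;> ring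

theorem szego_mulVec (a : Disc) (z x y : ℂ) :
    szego a z *ᵥ ![x, y] = ![(rho a : ℂ)⁻¹ * (z * x - conj (a : ℂ) * y),
      (rho a : ℂ)⁻¹ * (-(a : ℂ) * z * x + y)] := by
  ext i
  fin_cases i <;> simp [szego, Matrix.mulVec, dotProduct, Fin.sum_univ_two] <;> ring

/-- The Szegő step expresses the relations imposed by one block of the factorization. -/
theorem szego_step_iff (a : Disc) (z u v u' v' : ℂ) :
    szego a z *ᵥ ![u, v] = ![v', z * u'] ↔
      conj (a : ℂ) * v + (rho a : ℂ) * v' = z * u ∧ (rho a : ℂ) * v - (a : ℂ) * v' = z * u' := by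
  have h0 := rho_ne_zero a
  have h1 := rho_mul_self a
  rw [szego_mulVec]
  constructor
  · intro h
    have e1 : (rho a : ℂ)⁻¹ * (z * u - conj (a : ℂ) * v) = v' := congrFun h 0
    have e2 : (rho a : ℂ)⁻¹ * (-(a : ℂ) * z * u + v) = z * u' := congrFun h 1
    rw [← e1, ← e2]
    constructor
    · field_simp
      ring
    · field_simp
      linear_combination v * h1
  · rintro ⟨e1, e2⟩
    have e3 : (rho a : ℂ)⁻¹ * (z * u - conj (a : ℂ) * v) = v' := by
      rw [← e1]
      field_simp
      ring
    have e4 : (rho a : ℂ)⁻¹ * (-(a : ℂ) * z * u + v) = z * u' := by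
      rw [← e2]
      field_simp
      linear_combination (a : ℂ) * e1 - v * h1
    rw [e3, e4]

/-- A factor `z` comes out of the step, leaving the previous relation at spectral parameter `1` with
`u` and `v` exchanged. This factor, gained once every two sites, explains the power `z ^ (m / 2)` in
`szegoVec`. -/
theorem szego_step_iff' (a : Disc) {z : ℂ} (hz : z ≠ 0) (u v u' v' : ℂ) :
    szego a z *ᵥ ![v, z * u] = z • ![u', v'] ↔
      conj (a : ℂ) * u + (rho a : ℂ) * u' = v ∧ (rho a : ℂ) * u - (a : ℂ) * u' = v' := by
  have h := szego_step_iff a 1 v u v' u'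
  rw [one_mul, one_mul] at h
  rw [← h]
  have h2 : szego a z *ᵥ ![v, z * u] = z • (szego a 1 *ᵥ ![v, u]) := by
    rw [szego_mulVec, szego_mulVec]
    ext i
    fin_cases i <;> simp <;> ring
  rw [h2]
  exact (smul_right_injective _ hz).eq_iff

/-- The Szegő cocycle vector attached to a pair of sequences `u`, `v`. -/
noncomputable def szegoVec (z : ℂ) (u v : ℤ → ℂ) (m : ℤ) : Fin 2 → ℂ :=
  z ^ (m / 2) • if Even m then ![u m, v m] else ![v m, z * u m]

theorem szegoVec_step_iff_of_even {m : ℤ} (hm : Even m) (ω : ℤ → Disc) {z : ℂ} (hz : z ≠ 0)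
    (u v : ℤ → ℂ) :
    szegoVec z u v (m + 1) = szego (ω m) z *ᵥ szegoVec z u v m ↔
      blockSum 0 ω v m = z * u m ∧ blockSum 0 ω v (m + 1) = z * u (m + 1) := by
  have hm' : ¬Even (m + 1) := by
    rw [Int.even_add_one]
    exact not_not.2 hm
  have hd : (m + 1) / 2 = m / 2 := by
    obtain ⟨j, rfl⟩ := hm
    omega
  have hm0 : Even (m + 0) := by rwa [add_zero]
  rw [szegoVec, szegoVec, if_pos hm, if_neg hm', hd, Matrix.mulVec_smul,
    (smul_right_injective _ (zpow_ne_zero _ hz)).eq_iff, blockSum_of_even hm0,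
    blockSum_add_one_of_even hm0, eq_comm, szego_step_iff]

theorem szegoVec_step_iff_of_odd {m : ℤ} (hm : ¬Even m) (ω : ℤ → Disc) {z : ℂ} (hz : z ≠ 0)
    (u v : ℤ → ℂ) :
    szegoVec z u v (m + 1) = szego (ω m) z *ᵥ szegoVec z u v m ↔
      blockSum 1 ω u m = v m ∧ blockSum 1 ω u (m + 1) = v (m + 1) := by
  have hm' : Even (m + 1) := Int.even_add_one.2 hm
  have hd : (m + 1) / 2 = m / 2 + 1 := by
    obtain ⟨j, hj⟩ := hm'
    omega
  rw [szegoVec, szegoVec, if_neg hm, if_pos hm', hd, Matrix.mulVec_smul, zpow_add_one₀ hz,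
    mul_smul, (smul_right_injective _ (zpow_ne_zero _ hz)).eq_iff, blockSum_of_even hm',
    blockSum_add_one_of_even hm', eq_comm, szego_step_iff' _ hz]

/-- Solutions of the eigenvalue equation are carried by the Szegő transfer matrices. -/
theorem szegoVec_add (ω : ℤ → Disc) {z : ℂ} (hz : z ≠ 0) {u : ℤ → ℂ}
    (hu : ∀ n, act ω u n = z * u n) (m : ℤ) (k : ℕ) :
    szegoVec z u (blockSum 1 ω u) (m + k) =
      transfer ω z m k *ᵥ szegoVec z u (blockSum 1 ω u) m := by
  have hstep : ∀ m : ℤ, szegoVec z u (blockSum 1 ω u) (m + 1) =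
      szego (ω m) z *ᵥ szegoVec z u (blockSum 1 ω u) m := fun m => by
    by_cases hm : Even m
    · rw [szegoVec_step_iff_of_even hm ω hz, ← act_eq_blockSum]
      exact ⟨hu _, hu _⟩
    · rw [szegoVec_step_iff_of_odd hm ω hz]
      exact ⟨rfl, rfl⟩
  induction k with
  | zero => simp [transfer]
  | succ k ih =>
    rw [transfer, ← Matrix.mulVec_mulVec, ← ih, ← hstep]
    congr 1
    push_cast
    ring

/-- A half-line orbit of the Szegő cocycle gives a solution of the eigenvalue equation. -/
theorem exists_solution_of_orbit (ω : ℤ → Disc) {z : ℂ} (hz : ‖z‖ = 1) (m₀ : ℤ)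
    {Y : ℤ → Fin 2 → ℂ} (hY : ∀ m ≥ m₀, Y (m + 1) = szego (ω m) z *ᵥ Y m) :
    ∃ u : ℤ → ℂ, (∀ n ≥ m₀ + 2, act ω u n = z * u n) ∧
      ∀ n, ‖u n‖ = ‖Y n (if Even n then 0 else 1)‖ := by
  have hz0 : z ≠ 0 := fun h => by simp [h] at hz
  set u : ℤ → ℂ := fun m => if Even m then (z ^ (m / 2))⁻¹ * Y m 0
    else z⁻¹ * ((z ^ (m / 2))⁻¹ * Y m 1) with hu
  set v : ℤ → ℂ := fun m => if Even m then (z ^ (m / 2))⁻¹ * Y m 1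
    else (z ^ (m / 2))⁻¹ * Y m 0 with hv
  have hYv : szegoVec z u v = Y := by
    funext m i
    have hp : z ^ (m / 2) ≠ 0 := zpow_ne_zero _ hz0
    by_cases hm : Even m <;> fin_cases i <;> simp [szegoVec, hu, hv, hm, hz0, hp]
  have hv1 : ∀ n > m₀, blockSum 1 ω u n = v n := fun n hn => by
    by_cases h : Even n
    · have h1 : ¬Even (n - 1) := by
        rw [Int.even_sub_one]
        exact not_not.2 h
      have h2 := hY (n - 1) (by omega)
      rw [← hYv] at h2
      have := ((szegoVec_step_iff_of_odd h1 ω hz0 u v).1 h2).2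
      rwa [sub_add_cancel] at this
    · have h2 := hY n (by omega)
      rw [← hYv] at h2
      exact ((szegoVec_step_iff_of_odd h ω hz0 u v).1 h2).1
  have hu1 : ∀ n > m₀, blockSum 0 ω v n = z * u n := fun n hn => by
    by_cases h : Even n
    · have h2 := hY n (by omega)
      rw [← hYv] at h2
      exact ((szegoVec_step_iff_of_even h ω hz0 u v).1 h2).1
    · have h1 : Even (n - 1) := Int.even_sub_one.2 h
      have h2 := hY (n - 1) (by omega)
      rw [← hYv] at h2
      have := ((szegoVec_step_iff_of_even h1 ω hz0 u v).1 h2).2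
      rwa [sub_add_cancel] at this
  refine ⟨u, fun n hn => ?_, fun n => ?_⟩
  -- The outer block may use the inner relation at `n - 1`, which must exceed `m₀`: hence the bound
  -- `m₀ + 2`.
  · rw [← hu1 n (by omega), act_eq_blockSum, blockSum, hv1 n (by omega), hv1 (n + 1) (by omega),
      hv1 (n - 1) (by omega)]
    rfl
  · by_cases hn : Even n <;> simp [hu, hn, hz]

/-! ### Zeros of the discriminant lie on the unit circle. -/

/-- The indefinite form preserved by the Szegő matrices on the unit circle. -/
noncomputable def signedNormSq (x : Fin 2 → ℂ) : ℝ := ‖x 0‖ ^ 2 - ‖x 1‖ ^ 2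

theorem signedNormSq_szego (a : Disc) (z : ℂ) (x : Fin 2 → ℂ) :
    signedNormSq (szego a z *ᵥ x) = ‖z‖ ^ 2 * ‖x 0‖ ^ 2 - ‖x 1‖ ^ 2 := by
  have hx : x = ![x 0, x 1] := by
    ext i
    fin_cases i <;> rfl
  have h0 := rho_ne_zero a
  have h1 := rho_mul_self a
  have h2 : signedNormSq (szego a z *ᵥ ![x 0, x 1]) = ‖z‖ ^ 2 * ‖x 0‖ ^ 2 - ‖x 1‖ ^ 2 := by
    rw [szego_mulVec, signedNormSq]
    simp only [← Complex.normSq_eq_norm_sq, Matrix.cons_val_zero, Matrix.cons_val_one]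
    rw [← Complex.ofReal_inj]
    simp only [Complex.ofReal_sub, Complex.ofReal_mul, ← Complex.mul_conj]
    simp only [map_add, map_sub, map_mul, map_neg, map_inv₀, Complex.conj_conj, Complex.conj_ofReal]
    field_simp
    rw [pow_two, h1]
    ring
  rwa [← hx] at h2

/-- The form does not increase along the cocycle if `‖z‖ < 1` and does not decrease if `‖z‖ > 1`.
Starting from `-1` at `![0, 1]`, it would have to end at `-‖z‖ ^ (2 * n)`, on the wrong side of `-1`
in either case. -/
theorem norm_eq_one_of_sq_eq (ω : ℤ → Disc) {z : ℂ} {m : ℤ} {k n : ℕ} (hn : n ≠ 0)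
    (h : transfer ω z m k = -z ^ n • (1 : Matrix (Fin 2) (Fin 2) ℂ)) : ‖z‖ = 1 := by
  have hq : signedNormSq (transfer ω z m k *ᵥ ![0, 1]) = -(‖z‖ ^ n) ^ 2 := by
    rw [h, Matrix.smul_mulVec, Matrix.one_mulVec]
    simp [signedNormSq]
  have hz0 : 0 ≤ ‖z‖ := norm_nonneg z
  rcases lt_trichotomy ‖z‖ 1 with hlt | heq | hgt
  · have hle : ∀ j, signedNormSq (transfer ω z m j *ᵥ ![0, 1]) ≤ -1 := fun j => by
      induction j with
      | zero => simp [transfer, signedNormSq]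
      | succ j ih =>
        rw [transfer, ← Matrix.mulVec_mulVec, signedNormSq_szego]
        rw [signedNormSq] at ih
        nlinarith [sq_nonneg ‖(transfer ω z m j *ᵥ ![0, 1]) 0‖, pow_le_one₀ (n := 2) hz0 hlt.le]
    have h1 := hle k
    have h2 : ‖z‖ ^ n < 1 := pow_lt_one₀ hz0 hlt hn
    nlinarith [pow_nonneg hz0 n]
  · exact heq
  · have hge : ∀ j, -1 ≤ signedNormSq (transfer ω z m j *ᵥ ![0, 1]) := fun j => by
      induction j with
      | zero => simp [transfer, signedNormSq]
      | succ j ih =>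
        rw [transfer, ← Matrix.mulVec_mulVec, signedNormSq_szego]
        rw [signedNormSq] at ih
        nlinarith [sq_nonneg ‖(transfer ω z m j *ᵥ ![0, 1]) 0‖, one_le_pow₀ (n := 2) hgt.le]
    have h1 := hge k
    have h2 : 1 < ‖z‖ ^ n := one_lt_pow₀ hgt hn
    nlinarith

/-- The periodic sequence that agrees with `ω` on `[m, m + n)`. -/
def periodize (ω : ℤ → Disc) (m : ℤ) (n : ℕ) (i : ℤ) : Disc := ω (m + (i - m) % n)

theorem periodize_periodic (ω : ℤ → Disc) (m : ℤ) (n : ℕ) :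
    Function.Periodic (periodize ω m n) n := fun i => by
  rw [periodize, periodize, add_sub_right_comm, Int.add_emod_right]

theorem periodize_eq (ω : ℤ → Disc) {m i : ℤ} {n : ℕ} (h1 : m ≤ i) (h2 : i < m + n) :
    periodize ω m n i = ω i := by
  rw [periodize, Int.emod_eq_of_lt (by omega) (by omega)]
  congr 1
  ring

theorem transfer_periodize (ω : ℤ → Disc) (z : ℂ) (m : ℤ) (n : ℕ) :
    transfer (periodize ω m n) z m n = transfer ω z m n :=
  transfer_congr (fun i hi => periodize_eq ω (by omega) (by omega)) z

theorem transfer_add_period {η : ℤ → Disc} {p : ℕ} (hη : Function.Periodic η p) (z : ℂ) (m : ℤ)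
    (k : ℕ) : transfer η z m (p + k) = transfer η z m k * transfer η z m p := by
  rw [transfer_add]
  congr 1
  refine transfer_congr (fun i _ => ?_) z
  rw [add_right_comm]
  exact hη _

theorem transfer_two_periods {η : ℤ → Disc} {n : ℕ} (hη : Function.Periodic η n) {z : ℂ} {m : ℤ}
    (h : (transfer η z m n).trace = 0) : transfer η z m (n + n) = -z ^ n • 1 := by
  rw [transfer_add_period hη, mul_self_fin_two, h, det_transfer, zero_smul, zero_sub, neg_smul]

theorem norm_eq_one_of_discriminant_eq_zero (ω : ℤ → Disc) {l r : ℕ} {z : ℂ}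
    (h : discriminant ω l r z = 0) : ‖z‖ = 1 := by
  rw [discriminant_eq, ← transfer_periodize] at h
  exact norm_eq_one_of_sq_eq _ (Nat.succ_ne_zero (l + r))
    (transfer_two_periods (periodize_periodic ω _ _) h)

/-! ### Zeros of the discriminant belong to the approximate spectrum. -/

theorem norm_act_le (ω : ℤ → Disc) {u : ℤ → ℂ} {B : ℝ} (hB : ∀ n, ‖u n‖ ≤ B) (n : ℤ) :
    ‖act ω u n‖ ≤ 5 * B := by
  have h : ∀ m, ‖entry ω n m * u m‖ ≤ B := fun m => by
    rw [norm_mul]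
    exact (mul_le_of_le_one_left (norm_nonneg _) (norm_entry_le_one ω n m)).trans (hB m)
  rw [act]
  refine (norm_add_le _ _).trans ?_
  refine (add_le_add_left (norm_add_le _ _) _).trans ?_
  refine (add_le_add_left (add_le_add_left (norm_add_le _ _) _) _).trans ?_
  refine (add_le_add_left (add_le_add_left (add_le_add_left (norm_add_le _ _) _) _) _).trans ?_
  linarith [h (n - 2), h (n - 1), h n, h (n + 1), h (n + 2)]

theorem act_congr {ω η : ℤ → Disc} {u v : ℤ → ℂ} {n : ℤ} (hω : ∀ m, |m - n| ≤ 2 → ω m = η m)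
    (hu : ∀ m, |m - n| ≤ 2 → u m = v m) : act ω u n = act η v n := by
  simp (disch := norm_num) only [act, entry, hu (n - 2), hu (n - 1), hu n, hu (n + 1), hu (n + 2),
    hω (n - 2), hω (n - 1), hω n, hω (n + 1)]

theorem memℓp_of_supportedIn {L : ℕ} {u : ℤ → ℂ} (hu : SupportedIn L u) :
    Memℓp (E := fun _ : ℤ => ℂ) u 2 := by
  refine (memℓp_zero ((Finset.finite_toSet (Finset.Icc (-L : ℤ) L)).subset
    fun n hn => ?_)).of_exponent_ge zero_le
  rw [Finset.coe_Icc, Set.mem_Icc, ← abs_le]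
  by_contra! h
  exact hn (hu n h)

/-- A bounded half-line solution that does not decay yields approximate eigenvectors. -/
theorem exists_approx_of_bounded_solution (η : ℤ → Disc) {z : ℂ} (hz : ‖z‖ = 1) (m₀ : ℤ)
    {u : ℤ → ℂ} {B : ℝ} (hB : ∀ n, ‖u n‖ ≤ B) (hu : ∀ n ≥ m₀ + 2, act η u n = z * u n) {N : ℕ}
    (hN : 0 < N) (h1 : ∀ k : ℕ, ‖u (m₀ + N * k)‖ = 1) {ε : ℝ} (hε : 0 < ε) :
    ∃ (L : ℕ) (v : H), SupportedIn L v ∧ ‖extendedCMV η v - z • v‖ < ε * ‖v‖ := by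
  have hB0 : 0 ≤ B := (norm_nonneg _).trans (hB 0)
  -- Cutting the solution to `K` periods leaves a residual at no more than eight edge sites, each at
  -- most `5 * B + B`, while the squared norm is at least `K`.
  obtain ⟨K, hK⟩ := exists_nat_gt (8 * (6 * B) ^ 2 / ε ^ 2)
  set M : ℤ := N * K with hM
  have hM0 : 0 ≤ M := by positivity
  set w : ℤ → ℂ := fun n => if m₀ ≤ n ∧ n < m₀ + M then u n else 0 with hw
  have hwB : ∀ n, ‖w n‖ ≤ B := fun n => by
    simp only [hw]
    split_ifs
    · exact hB n
    · simpa using hB0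
  have hwin : ∀ n, m₀ ≤ n → n < m₀ + M → w n = u n := fun n h h' => if_pos ⟨h, h'⟩
  have hwout : ∀ n, n < m₀ ∨ m₀ + M ≤ n → w n = 0 := fun n h => if_neg (by omega)
  have hws : SupportedIn (m₀.natAbs + M.natAbs) w := fun n hn => by
    refine hwout n ?_
    rw [Int.abs_eq_natAbs] at hn
    omega
  let v : H := ⟨w, memℓp_of_supportedIn hws⟩
  refine ⟨_, v, hws, ?_⟩
  have hlow : (K : ℝ) ≤ ‖v‖ ^ 2 := by
    rw [norm_sq_eq_sum (u := v) (s := Finset.Ico m₀ (m₀ + M)) fun n hn => hwout n (by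
      rw [Finset.mem_Ico] at hn
      omega)]
    have hinj : Set.InjOn (fun k : ℕ => m₀ + (N : ℤ) * k) (Finset.range K) := fun a _ b _ h => by
      have h2 := mul_left_cancel₀ (by positivity : (N : ℤ) ≠ 0) (add_left_cancel h)
      exact_mod_cast h2
    have hmem : ∀ k < K, m₀ ≤ m₀ + (N : ℤ) * k ∧ m₀ + (N : ℤ) * k < m₀ + M := fun k hk => by
      have h3 : (N : ℤ) * k < N * K := by
        have : (k : ℤ) < K := by exact_mod_cast hk
        have : (0 : ℤ) < N := by exact_mod_cast hN
        gcongr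
      have h4 : (0 : ℤ) ≤ N * k := by positivity
      omega
    calc (K : ℝ) = ∑ k ∈ Finset.range K, ‖w (m₀ + N * k)‖ ^ 2 := by
          rw [Finset.sum_congr rfl fun k hk => by
            have := hmem k (Finset.mem_range.1 hk)
            rw [hwin _ this.1 this.2, h1 k]]
          simp
      _ = ∑ n ∈ (Finset.range K).image fun k : ℕ => m₀ + (N : ℤ) * k, ‖w n‖ ^ 2 :=
          (Finset.sum_image hinj (f := fun n => ‖w n‖ ^ 2)).symm
      _ ≤ ∑ n ∈ Finset.Ico m₀ (m₀ + M), ‖w n‖ ^ 2 := by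
          refine Finset.sum_le_sum_of_subset_of_nonneg (fun n hn => ?_) fun n _ _ => sq_nonneg _
          obtain ⟨k, hk, rfl⟩ := Finset.mem_image.1 hn
          exact Finset.mem_Ico.2 (hmem k (Finset.mem_range.1 hk))
  have hup : ‖extendedCMV η v - z • v‖ ^ 2 ≤ 8 * (6 * B) ^ 2 := by
    have hc : ∀ n, (extendedCMV η v - z • v : H) n = act η w n - z * w n := fun n =>
      congrArg (· - z * w n) (congrFun (coe_extendedCMV η v) n)
    set t := Finset.Ico (m₀ - 2) (m₀ + 2) ∪ Finset.Ico (m₀ + M - 2) (m₀ + M + 2) with ht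
    have ht8 : (t.card : ℝ) ≤ 8 := by
      have : t.card ≤ 8 := (Finset.card_union_le _ _).trans (by simp only [Int.card_Ico]; omega)
      exact_mod_cast this
    rw [norm_sq_eq_sum (s := t) fun n hn => ?_]
    · calc _ ≤ ∑ n ∈ t, (6 * B) ^ 2 := Finset.sum_le_sum fun n _ => by
            refine pow_le_pow_left₀ (norm_nonneg _) ?_ 2
            rw [hc]
            refine (norm_sub_le _ _).trans ?_
            rw [norm_mul, hz, one_mul]
            linarith [norm_act_le η hwB n, hwB n]
        _ = t.card * (6 * B) ^ 2 := by rw [Finset.sum_const, nsmul_eq_mul]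
        _ ≤ 8 * (6 * B) ^ 2 := by gcongr
    · rw [ht, Finset.mem_union, Finset.mem_Ico, Finset.mem_Ico] at hn
      rw [hc]
      by_cases hin : m₀ + 2 ≤ n ∧ n < m₀ + M - 2
      · rw [hwin n (by omega) (by omega), ← hu n hin.1, sub_eq_zero]
        refine act_congr (fun _ _ => rfl) fun m hm => ?_
        rw [abs_le] at hm
        exact hwin m (by omega) (by omega)
      · have h0 : act η w n = act η (fun _ => 0) n := act_congr (fun _ _ => rfl) fun m hm => by
          rw [abs_le] at hm
          exact hwout m (by omega)
        rw [h0, hwout n (by omega)]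
        simp [act]
  have hlt : ‖extendedCMV η v - z • v‖ ^ 2 < (ε * ‖v‖) ^ 2 := by
    rw [div_lt_iff₀ (by positivity)] at hK
    nlinarith [sq_nonneg ε]
  exact (sq_lt_sq₀ (norm_nonneg _) (by positivity)).1 hlt

theorem exists_bound_of_periodic {g : ℕ → ℝ} (h0 : ∀ k, 0 ≤ g k) {N : ℕ} (hN : 0 < N)
    (hg : Function.Periodic g N) : ∃ B, ∀ k, g k ≤ B := by
  refine ⟨∑ k ∈ Finset.range N, g k, fun k => ?_⟩
  rw [← hg.map_mod_nat k]
  exact Finset.single_le_sum (fun i _ => h0 i) (Finset.mem_range.2 (Nat.mod_lt k hN))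

/-- Zeros of the discriminant belong to the approximate spectrum over any set containing the
Verblunsky coefficients. -/
theorem discriminantZeros_subset_approxSpectrum {K : Set Disc} {ω : ℤ → Disc}
    (hω : ∀ n, ω n ∈ K) (l r : ℕ) : discriminantZeros ω l r ⊆ approxSpectrum K := by
  intro z hz ε hε
  have hz1 := norm_eq_one_of_discriminant_eq_zero ω hz
  set m₀ : ℤ := -l with hm₀
  set n := l + r + 1 with hn
  set η := periodize ω m₀ n with hη
  have hηp : Function.Periodic η n := periodize_periodic ω m₀ n
  have hηp2 : Function.Periodic η ((n + n : ℕ) : ℤ) := by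
    push_cast
    exact hηp.add_period hηp
  have htr : (transfer η z m₀ n).trace = 0 := by
    rw [hη, transfer_periodize, ← discriminant_eq]
    exact hz
  have hT := transfer_two_periods hηp htr
  -- Starting from the vector with both entries `1` gives modulus one at every double period,
  -- whichever component the parity of the site selects.
  set W : ℕ → Fin 2 → ℂ := fun k => transfer η z m₀ k *ᵥ 1 with hW
  have hWp : ∀ k, W (k + (n + n)) = -z ^ n • W k := fun k => by
    simp only [hW]
    rw [add_comm k, transfer_add_period hηp2, hT, Matrix.mul_smul, Matrix.mul_one,
      Matrix.smul_mulVec]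
  have hWn : ∀ i, Function.Periodic (fun k => ‖W k i‖) (n + n) := fun i k => by
    simp only [hWp, Pi.smul_apply, norm_smul, norm_neg, norm_pow, hz1, one_pow, one_mul]
  choose B hB using fun i => exists_bound_of_periodic (fun k => norm_nonneg (W k i))
    (by omega) (hWn i)
  -- To the left of `m₀`, `toNat` freezes the orbit at `W 0`, so the bound holds on all of `ℤ`.
  obtain ⟨u, hu, hun⟩ := exists_solution_of_orbit η hz1 m₀ (Y := fun m => W (m - m₀).toNat)
    fun m hm => by
      obtain ⟨k, rfl⟩ := Int.le.dest hm
      have e1 : (m₀ + k + 1 - m₀).toNat = k + 1 := by omega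
      have e2 : (m₀ + k - m₀).toNat = k := by omega
      simp only [e1, e2, hW, transfer, Matrix.mulVec_mulVec]
  refine ⟨η, fun m => hω _, exists_approx_of_bounded_solution η hz1 m₀ (B := max (B 0) (B 1))
    (fun m => ?_) hu (N := n + n) (by omega) (fun k => ?_) hε⟩
  · rw [hun]
    split_ifs
    · exact (hB 0 _).trans (le_max_left _ _)
    · exact (hB 1 _).trans (le_max_right _ _)
  · have e1 : (m₀ + ((n + n : ℕ) : ℤ) * k - m₀).toNat = k * (n + n) := by
      rw [add_sub_cancel_left, mul_comm]
      exact_mod_cast Int.toNat_natCast _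
    rw [hun, e1]
    generalize (if Even (m₀ + ((n + n : ℕ) : ℤ) * k) then (0 : Fin 2) else 1) = i
    have h := (hWn i).nat_mul_eq k
    rw [Nat.cast_id] at h
    rw [h]
    simp only [hW, transfer, Matrix.one_mulVec, Pi.one_apply, norm_one]

/-! ### The finite unitary matrix with antiperiodic boundary conditions. -/

theorem blockSum_antiperiodic {p N : ℤ} (hN : Even N) {η : ℤ → Disc}
    (hη : Function.Periodic η N) {u : ℤ → ℂ} (hu : Function.Antiperiodic u N) :
    Function.Antiperiodic (blockSum p η u) N := fun n => by
  have e1 : n + N + 1 = n + 1 + N := by ring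
  have e2 : n + N - 1 = n - 1 + N := by ring
  have e3 : Even (n + N + p) ↔ Even (n + p) := by
    rw [add_right_comm, Int.even_add]
    simp [hN]
  rw [blockSum, blockSum, e1, e2, hu, hu, hu, hη, hη]
  simp only [e3]
  split_ifs <;> ring

theorem act_antiperiodic {N : ℤ} (hN : Even N) {η : ℤ → Disc}
    (hη : Function.Periodic η N) {u : ℤ → ℂ} (hu : Function.Antiperiodic u N) :
    Function.Antiperiodic (act η u) N := by
  rw [act_eq_blockSum]
  exact blockSum_antiperiodic hN hη (blockSum_antiperiodic hN hη hu)

theorem sum_range_periodic_succ {g : ℤ → ℝ} {N : ℕ} (hg : Function.Periodic g N) (a : ℤ) :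
    ∑ i ∈ Finset.range N, g (a + 1 + i) = ∑ i ∈ Finset.range N, g (a + i) := by
  have h1 := Finset.sum_range_succ (fun i : ℕ => g (a + i)) N
  have h2 := Finset.sum_range_succ' (fun i : ℕ => g (a + i)) N
  have h3 : g (a + N) = g a := hg a
  simp only [Nat.cast_add, Nat.cast_one, Nat.cast_zero, add_zero] at h2
  rw [h1, h3] at h2
  rw [add_right_cancel h2]
  refine Finset.sum_congr rfl fun i _ => ?_
  congr 1
  ring

/-- An even window starting at the left end of a block is a union of blocks; otherwise it is slid by
one site, which is harmless since the squared moduli are periodic. -/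
theorem sum_normSq_blockSum {p : ℤ} {n : ℕ} {η : ℤ → Disc} {u : ℤ → ℂ}
    (hη : Function.Periodic η ((n + n : ℕ) : ℤ)) (hu : Function.Antiperiodic u ((n + n : ℕ) : ℤ))
    (a : ℤ) : ∑ i ∈ Finset.range (n + n), ‖blockSum p η u (a + i)‖ ^ 2 =
      ∑ i ∈ Finset.range (n + n), ‖u (a + i)‖ ^ 2 := by
  have hN : Even ((n + n : ℕ) : ℤ) := ⟨n, by push_cast; ring⟩
  have hper : ∀ {w : ℤ → ℂ}, Function.Antiperiodic w ((n + n : ℕ) : ℤ) →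
      Function.Periodic (fun m => ‖w m‖ ^ 2) ((n + n : ℕ) : ℤ) := fun hw m => by
    simp only [hw m, norm_neg]
  have hpairs : ∀ (w : ℤ → ℂ) (b : ℤ) (k : ℕ), ∑ i ∈ Finset.range (k + k), ‖w (b + i)‖ ^ 2 =
      ∑ j ∈ Finset.range k, (‖w (b + 2 * j)‖ ^ 2 + ‖w (b + 2 * j + 1)‖ ^ 2) := fun w b k => by
    induction k with
    | zero => simp
    | succ k ih =>
      rw [show k + 1 + (k + 1) = k + k + 1 + 1 by ring, Finset.sum_range_succ,
        Finset.sum_range_succ, ih, Finset.sum_range_succ, add_assoc]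
      congr 5
      · push_cast
        ring
      · push_cast
        ring
  have heven : ∀ b : ℤ, Even (b + p) → ∑ i ∈ Finset.range (n + n), ‖blockSum p η u (b + i)‖ ^ 2 =
      ∑ i ∈ Finset.range (n + n), ‖u (b + i)‖ ^ 2 := fun b hb => by
    rw [hpairs, hpairs]
    refine Finset.sum_congr rfl fun j _ => normSq_blockSum_add ?_ η u
    rw [add_right_comm]
    exact hb.add (even_two_mul _)
  by_cases ha : Even (a + p)
  · exact heven a ha
  · rw [← sum_range_periodic_succ (hper (blockSum_antiperiodic hN hη hu)),
      ← sum_range_periodic_succ (hper hu)]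
    refine heven (a + 1) ?_
    rw [add_right_comm]
    exact Int.even_add_one.2 ha

theorem antiperiodic_add_mul {u : ℤ → ℂ} {N : ℤ} (hu : Function.Antiperiodic u N) (x q : ℤ) :
    u (x + N * q) = (-1) ^ q * u x := by
  induction q using Int.induction_on with
  | zero => simp
  | succ i ih =>
    rw [mul_add, mul_one, ← add_assoc, hu, ih, zpow_add_one₀ (by norm_num)]
    ring
  | pred i ih =>
    have h := hu (x + N * (-i - 1))
    rw [show x + N * (-(i : ℤ) - 1) + N = x + N * -i by ring, ih] at h
    rw [zpow_sub_one₀ (by norm_num), inv_neg_one]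
    linear_combination h

/-- The antiperiodic sequence with prescribed values on `[m₀, m₀ + N)`. -/
noncomputable def antiperiodize (m₀ : ℤ) (N : ℕ) [NeZero N] :
    EuclideanSpace ℂ (Fin N) →ₗ[ℂ] (ℤ → ℂ) where
  toFun f m := (-1) ^ ((m - m₀) / N) * f (Fin.ofNat N ((m - m₀) % N).toNat)
  map_add' f g := by
    funext m
    simp [mul_add]
  map_smul' c f := by
    funext m
    simp [mul_left_comm]

section Antiperiodize

variable (m₀ : ℤ) (N : ℕ) [NeZero N]

theorem antiperiodize_antiperiodic (f : EuclideanSpace ℂ (Fin N)) :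
    Function.Antiperiodic (antiperiodize m₀ N f) N := fun m => by
  have hN : (N : ℤ) ≠ 0 := by exact_mod_cast NeZero.ne N
  change (-1) ^ ((m + N - m₀) / N) * f (Fin.ofNat N ((m + N - m₀) % N).toNat) =
    -((-1) ^ ((m - m₀) / N) * f (Fin.ofNat N ((m - m₀) % N).toNat))
  rw [add_sub_right_comm, Int.add_emod_right, Int.add_ediv_of_dvd_right dvd_rfl,
    Int.ediv_self hN, zpow_add_one₀ (by norm_num)]
  ring

theorem antiperiodize_apply_add (f : EuclideanSpace ℂ (Fin N)) (i : Fin N) :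
    antiperiodize m₀ N f (m₀ + i) = f i := by
  change (-1) ^ ((m₀ + i - m₀) / N) * f (Fin.ofNat N ((m₀ + i - m₀) % N).toNat) = f i
  have h : ((i : ℕ) : ℤ) < N := by exact_mod_cast i.2
  rw [add_sub_cancel_left, Int.ediv_eq_zero_of_lt (by positivity) h,
    Int.emod_eq_of_lt (by positivity) h]
  simp

theorem antiperiodize_restrict {u : ℤ → ℂ} (hu : Function.Antiperiodic u N) :
    antiperiodize m₀ N (WithLp.toLp 2 fun i : Fin N => u (m₀ + i)) = u := by
  funext m
  have hN : (N : ℤ) ≠ 0 := by exact_mod_cast NeZero.ne N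
  have hN0 : (0 : ℤ) < N := by
    have := NeZero.pos N
    exact_mod_cast this
  have h1 := Int.emod_nonneg (m - m₀) hN
  have h2 := Int.emod_lt_of_pos (m - m₀) hN0
  change (-1) ^ ((m - m₀) / N) *
    u (m₀ + ((Fin.ofNat N ((m - m₀) % N).toNat : Fin N) : ℕ)) = u m
  have h3 : ((m - m₀) % N).toNat % N = ((m - m₀) % N).toNat := Nat.mod_eq_of_lt (by omega)
  rw [Fin.val_ofNat, h3, Int.toNat_of_nonneg h1, ← antiperiodic_add_mul hu]
  congr 1
  rw [add_assoc, Int.emod_add_mul_ediv]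
  ring

end Antiperiodize

/-- The extended CMV matrix acting on antiperiodic sequences. -/
noncomputable def antiperiodicCMV (η : ℤ → Disc) (m₀ : ℤ) (N : ℕ) [NeZero N] :
    EuclideanSpace ℂ (Fin N) →L[ℂ] EuclideanSpace ℂ (Fin N) :=
  LinearMap.toContinuousLinearMap
    { toFun := fun f => WithLp.toLp 2 fun i : Fin N => act η (antiperiodize m₀ N f) (m₀ + i)
      map_add' := fun f g => by
        ext i
        simp only [map_add, act, Pi.add_apply, PiLp.add_apply]
        ring
      map_smul' := fun c f => by
        ext i
        simp only [map_smul, act, Pi.smul_apply, PiLp.smul_apply, RingHom.id_apply, smul_eq_mul]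
        ring }

theorem antiperiodicCMV_apply (η : ℤ → Disc) (m₀ : ℤ) (N : ℕ) [NeZero N]
    (f : EuclideanSpace ℂ (Fin N)) (i : Fin N) :
    antiperiodicCMV η m₀ N f i = act η (antiperiodize m₀ N f) (m₀ + i) := rfl

theorem antiperiodize_antiperiodicCMV {η : ℤ → Disc} (m₀ : ℤ) {N : ℕ} [NeZero N]
    (hN : Even (N : ℤ)) (hη : Function.Periodic η N) (f : EuclideanSpace ℂ (Fin N)) :
    antiperiodize m₀ N (antiperiodicCMV η m₀ N f) = act η (antiperiodize m₀ N f) :=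
  antiperiodize_restrict m₀ N (act_antiperiodic hN hη (antiperiodize_antiperiodic m₀ N f))

theorem norm_sq_euclidean_eq {N : ℕ} (u : ℤ → ℂ) (m₀ : ℤ) (f : EuclideanSpace ℂ (Fin N))
    (h : ∀ i : Fin N, f i = u (m₀ + i)) :
    ‖f‖ ^ 2 = ∑ i ∈ Finset.range N, ‖u (m₀ + i)‖ ^ 2 := by
  rw [EuclideanSpace.norm_sq_eq, Finset.sum_range]
  exact Finset.sum_congr rfl fun i _ => by rw [h]

theorem antiperiodicCMV_mem_unitary {η : ℤ → Disc} (m₀ : ℤ) (n : ℕ) [NeZero (n + n)]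
    (hη : Function.Periodic η ((n + n : ℕ) : ℤ)) :
    antiperiodicCMV η m₀ (n + n) ∈ unitary _ := by
  have hN : Even ((n + n : ℕ) : ℤ) := ⟨n, by push_cast; ring⟩
  have hnorm : ∀ f, ‖antiperiodicCMV η m₀ (n + n) f‖ = ‖f‖ := fun f => by
    have hf := antiperiodize_antiperiodic m₀ (n + n) f
    refine (sq_eq_sq₀ (norm_nonneg _) (norm_nonneg _)).1 ?_
    rw [norm_sq_euclidean_eq _ m₀ _ (antiperiodicCMV_apply η m₀ (n + n) f),
      norm_sq_euclidean_eq _ m₀ f fun i => (antiperiodize_apply_add m₀ (n + n) f i).symm,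
      act_eq_blockSum, sum_normSq_blockSum hη (blockSum_antiperiodic hN hη hf),
      sum_normSq_blockSum hη hf]
  refine mem_unitary_of_norm_map _ hnorm ?_
  exact LinearMap.injective_iff_surjective.1
    (AddMonoidHomClass.isometry_of_norm (antiperiodicCMV η m₀ (n + n)) hnorm).injective

/-- Spectral points of the antiperiodic CMV matrix over two periods are zeros of the trace of the
transfer matrix over one period. -/
theorem trace_transfer_eq_zero {η : ℤ → Disc} (m₀ : ℤ) (n : ℕ) [NeZero (n + n)]
    (hη : Function.Periodic η n) {z : ℂ}
    (hz : z ∈ spectrum ℂ (antiperiodicCMV η m₀ (n + n))) : (transfer η z m₀ n).trace = 0 := by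
  have hN : Even ((n + n : ℕ) : ℤ) := ⟨n, by push_cast; ring⟩
  have hη2 : Function.Periodic η ((n + n : ℕ) : ℤ) := by
    push_cast
    exact hη.add_period hη
  have hz1 : ‖z‖ = 1 :=
    spectrum.norm_eq_one_of_unitary (antiperiodicCMV_mem_unitary m₀ n hη2) hz
  have hz0 : z ≠ 0 := fun h => by simp [h] at hz1
  set U := antiperiodicCMV η m₀ (n + n) with hU
  obtain ⟨f, hf0, hf⟩ : ∃ f, f ≠ 0 ∧ U f = z • f := by
    by_contra! hcon
    refine hz (ContinuousLinearMap.isUnit_iff_bijective.2 ?_)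
    have hinj : Function.Injective
        (algebraMap ℂ (EuclideanSpace ℂ (Fin (n + n)) →L[ℂ] EuclideanSpace ℂ (Fin (n + n))) z - U) := by
      rw [injective_iff_map_eq_zero]
      intro f hf
      by_contra h0
      refine hcon f h0 ?_
      rw [sub_apply, ContinuousLinearMap.algebraMap_apply, sub_eq_zero] at hf
      exact hf.symm
    exact ⟨hinj, LinearMap.injective_iff_surjective.1 hinj⟩
  set u := antiperiodize m₀ (n + n) f with hu
  have hua : Function.Antiperiodic u ((n + n : ℕ) : ℤ) :=
    antiperiodize_antiperiodic m₀ (n + n) f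
  have hact : ∀ m, act η u m = z * u m := fun m => by
    rw [hu, ← antiperiodize_antiperiodicCMV m₀ hN hη2, ← hU, hf, map_smul]
    rfl
  set Y := szegoVec z u (blockSum 1 η u) with hY
  have hYadd : ∀ k : ℕ, Y (m₀ + k) = transfer η z m₀ k *ᵥ Y m₀ := szegoVec_add η hz0 hact m₀
  have hY0 : Y m₀ ≠ 0 := fun h0 => by
    refine hf0 ?_
    ext i
    have h1 := hYadd i
    rw [h0, Matrix.mulVec_zero, hY, szegoVec,
      smul_eq_zero_iff_right (zpow_ne_zero _ hz0)] at h1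
    rw [← antiperiodize_apply_add m₀ (n + n) f i, ← hu]
    change u (m₀ + i) = 0
    split_ifs at h1
    · exact congrFun h1 0
    · exact (mul_eq_zero.1 (congrFun h1 1)).resolve_left hz0
  -- Both sequences change sign over two periods, and the normalization `z ^ (m / 2)` contributes `z
  -- ^ n`.
  have hYN : Y (m₀ + (n + n : ℕ)) = -z ^ n • Y m₀ := by
    have hdiv : (m₀ + (n + n : ℕ)) / 2 = m₀ / 2 + n := by omega
    have hev : Even (m₀ + (n + n : ℕ)) ↔ Even m₀ := by
      rw [Int.even_add]
      exact iff_true_right hN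
    have hva := blockSum_antiperiodic (p := 1) hN hη2 hua m₀
    rw [hY, szegoVec, szegoVec, hua m₀, hva, hdiv, zpow_add₀ hz0, zpow_natCast]
    simp only [hev]
    ext i
    fin_cases i <;> split_ifs <;> simp <;> ring
  -- Comparing with `hYN`, the scalar terms cancel and `tr T • (T *ᵥ Y m₀) = 0` remains; `T` is
  -- invertible and `Y m₀` nonzero.
  have hTT : transfer η z m₀ (n + n) =
      (transfer η z m₀ n).trace • transfer η z m₀ n - z ^ n • 1 := by
    rw [transfer_add_period hη, mul_self_fin_two, det_transfer]
  rw [hYadd, hTT, Matrix.sub_mulVec, Matrix.smul_mulVec, Matrix.smul_mulVec, Matrix.one_mulVec,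
    neg_smul, sub_eq_neg_self, smul_eq_zero] at hYN
  refine hYN.resolve_right fun h => hY0 (Matrix.eq_zero_of_mulVec_eq_zero ?_ h)
  rw [det_transfer]
  exact pow_ne_zero _ hz0

/-! ### Approximation of the spectrum by zeros, and Hausdorff convergence. -/

/-- An approximate eigenvector supported well inside the window forces a nearby zero of the
discriminant. -/
theorem exists_discriminantZero_near (ω : ℤ → Disc) {L l r : ℕ} {v : H} (hv : SupportedIn L v)
    {z : ℂ} {ε : ℝ} (hε : 0 < ε) (hlt : ‖extendedCMV ω v - z • v‖ < ε * ‖v‖)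
    (hl : L + 5 ≤ l) (hr : L + 5 ≤ r) : ∃ w ∈ discriminantZeros ω l r, dist w z < ε := by
  set m₀ : ℤ := -l with hm₀
  set n := l + r + 1 with hn
  have hne : NeZero (n + n) := ⟨by omega⟩
  set η := periodize ω m₀ n with hη
  have hηp : Function.Periodic η n := periodize_periodic ω m₀ n
  have hηp2 : Function.Periodic η ((n + n : ℕ) : ℤ) := by
    push_cast
    exact hηp.add_period hηp
  set f : EuclideanSpace ℂ (Fin (n + n)) := WithLp.toLp 2 fun i => v (m₀ + i) with hf
  set u := antiperiodize m₀ (n + n) f with hu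
  have hua : Function.Antiperiodic u ((n + n : ℕ) : ℤ) := antiperiodize_antiperiodic m₀ (n + n) f
  have huin : ∀ m, m₀ ≤ m → m < m₀ + (n + n : ℕ) → u m = v m := fun m h1 h2 => by
    obtain ⟨k, rfl⟩ := Int.le.dest h1
    exact antiperiodize_apply_add m₀ (n + n) f ⟨k, by omega⟩
  have hvout : ∀ m : ℤ, m < -L ∨ L < m → v m = 0 := fun m hm => hv m (by
    rw [lt_abs]
    omega)
  -- The matrix reaches two sites. Just beyond the double window, antiperiodicity copies values of
  -- `v`, up to sign, from the opposite end, where the margin makes them zero.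
  have huv : ∀ m, m₀ - 2 ≤ m → m < m₀ + (n + n : ℕ) + 2 → u m = v m := fun m h1 h2 => by
    rcases lt_or_ge m m₀ with h3 | h3
    · have h4 := hua m
      rw [huin _ (by omega) (by omega), hvout _ (by omega)] at h4
      rw [hvout m (by omega), ← neg_eq_zero, ← h4]
    · rcases lt_or_ge m (m₀ + (n + n : ℕ)) with h4 | h4
      · exact huin m h3 h4
      · have h5 := hua (m - (n + n : ℕ))
        rw [sub_add_cancel, huin (m - (n + n : ℕ)) (by omega) (by omega), hvout _ (by omega),
          neg_zero] at h5
        rw [h5, hvout m (by omega)]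
  have hact : ∀ m, m₀ ≤ m → m < m₀ + (n + n : ℕ) → act η u m = act ω v m := fun m h1 h2 => by
    by_cases hm : |m| ≤ L + 2
    · rw [abs_le] at hm
      refine act_congr (fun j hj => ?_) fun j hj => ?_ <;> rw [abs_le] at hj
      · exact periodize_eq ω (by omega) (by omega)
      · exact huv j (by omega) (by omega)
    · rw [act_eq_zero hv ω (not_le.1 hm)]
      have h0 : act η u m = act η (fun _ => 0) m := act_congr (fun _ _ => rfl) fun j hj => by
        rw [abs_le] at hj hm
        rw [huv j (by omega) (by omega), hvout j (by omega)]
      rw [h0]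
      simp [act]
  set U := antiperiodicCMV η m₀ (n + n) with hU
  have hsum : ∀ g : ℤ → ℝ, ∑ i ∈ Finset.range (n + n), g (m₀ + i) =
      ∑ m ∈ Finset.Ico m₀ (m₀ + (n + n : ℕ)), g m := fun g => by
    rw [← Finset.sum_image (f := g) (g := fun i : ℕ => m₀ + (i : ℤ))
      fun a _ b _ h => by simpa using h]
    congr 1
    ext m
    rw [Finset.mem_image, Finset.mem_Ico]
    constructor
    · rintro ⟨i, hi, rfl⟩
      rw [Finset.mem_range] at hi
      omega
    · rintro ⟨h1, h2⟩
      exact ⟨(m - m₀).toNat, Finset.mem_range.2 (by omega), by omega⟩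
  have hnf : ‖f‖ = ‖v‖ := by
    refine (sq_eq_sq₀ (norm_nonneg _) (norm_nonneg _)).1 ?_
    rw [norm_sq_euclidean_eq v m₀ f fun i => rfl, hsum fun m => ‖v m‖ ^ 2]
    refine (norm_sq_eq_sum fun m hm => hvout m ?_).symm
    rw [Finset.mem_Ico] at hm
    omega
  -- Equality, not an estimate: the wrap-around entries meet only zeros of `v`, and `η = ω` near its
  -- support.
  have hnU : ‖U f - z • f‖ = ‖extendedCMV ω v - z • v‖ := by
    have hc : ∀ m, (extendedCMV ω v - z • v : H) m = act ω v m - z * v m := fun m =>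
      congrArg (· - z * v m) (congrFun (coe_extendedCMV ω v) m)
    refine (sq_eq_sq₀ (norm_nonneg _) (norm_nonneg _)).1 ?_
    rw [norm_sq_euclidean_eq (extendedCMV ω v - z • v : H) m₀ (U f - z • f) fun i => ?_,
      hsum fun m => ‖(extendedCMV ω v - z • v : H) m‖ ^ 2]
    · refine (norm_sq_eq_sum fun m hm => ?_).symm
      rw [Finset.mem_Ico] at hm
      rw [hc, act_eq_zero hv ω (by rw [lt_abs]; omega), hvout m (by omega)]
      simp
    · rw [hc, ← hact _ (by omega) (by have := i.2; omega)]
      rfl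
  obtain ⟨w, hw, hd⟩ := exists_spectrum_near U
    (isStarNormal_of_mem_unitary (antiperiodicCMV_mem_unitary m₀ n hηp2)) z hε
    (x := f) (by rw [hnU, hnf]; exact hlt)
  refine ⟨w, ?_, hd⟩
  rw [discriminantZeros, Set.mem_ofPred_eq, discriminant_eq, ← transfer_periodize]
  exact trace_transfer_eq_zero m₀ n hηp hw

theorem tendsto_hausdorffEDist_discriminantZeros {K : Set Disc} {ω : ℤ → Disc}
    (hω : ∀ n, ω n ∈ K) (hspec : spectrum ℂ (extendedCMV ω) = approxSpectrum K) {l r : ℕ → ℕ}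
    (hl : Tendsto l atTop atTop) (hr : Tendsto r atTop atTop) :
    Tendsto (fun k => Metric.hausdorffEDist (discriminantZeros ω (l k) (r k)) (approxSpectrum K))
      atTop (𝓝 0) := by
  rw [ENNReal.tendsto_nhds_zero]
  intro δ hδ
  obtain ⟨ε, hε0, hεδ⟩ : ∃ ε : ℝ, 0 < ε ∧ ENNReal.ofReal ε ≤ δ := by
    rcases eq_or_ne δ ∞ with h | h
    · exact ⟨1, one_pos, by rw [h]; exact le_top⟩
    · exact ⟨δ.toReal, ENNReal.toReal_pos hδ.ne' h, ENNReal.ofReal_toReal_le⟩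
  have hcomp : IsCompact (approxSpectrum K) := by
    rw [← hspec]
    exact spectrum.isCompact _
  have hε2 : 0 < ε / 2 := by positivity
  -- A finite `ε / 2`-net requires only finitely many test vectors, hence one common threshold for
  -- `k`; the other half of `ε` is spent on the distance to a zero.
  obtain ⟨t, ht, htf, hcov⟩ := hcomp.finite_cover_balls hε2
  have hev : ∀ᶠ k in atTop, ∀ z ∈ t, ∃ w ∈ discriminantZeros ω (l k) (r k), dist w z < ε / 2 := by
    rw [eventually_all_finite htf]
    intro z hz
    obtain ⟨L, v, hv, hlt⟩ :=
      exists_supported_approx_eigenvector ω (hspec.symm ▸ ht hz) hε2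
    filter_upwards [hl.eventually_ge_atTop (L + 5), hr.eventually_ge_atTop (L + 5)] with k h1 h2
    exact exists_discriminantZero_near ω hv hε2 hlt h1 h2
  filter_upwards [hev] with k hk
  refine (Metric.hausdorffEDist_le_of_mem_edist (fun w hw => ?_) fun z hz => ?_).trans hεδ
  · exact ⟨w, discriminantZeros_subset_approxSpectrum hω _ _ hw, by simp⟩
  · obtain ⟨y, hy, hzy⟩ := Set.mem_iUnion₂.1 (hcov hz)
    obtain ⟨w, hw, hwy⟩ := hk y hy
    refine ⟨w, hw, ?_⟩
    rw [edist_dist]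
    refine ENNReal.ofReal_le_ofReal ?_
    have := dist_triangle_right z w y
    rw [Metric.mem_ball] at hzy
    linarith

end CMV

theorem theorem3p4 (ν : Measure CMV.Disc) [IsProbabilityMeasure ν] (hν : IsCompact ν.support) :
    ∃ S : Set ℂ, IsClosed S ∧ S ⊆ Metric.sphere (0 : ℂ) 1 ∧
      (∀ᵐ ω ∂(Measure.infinitePi fun _ : ℤ => ν), spectrum ℂ (CMV.extendedCMV ω) = S) ∧
      ∀ l r : ℕ → ℕ, Tendsto l atTop atTop → Tendsto r atTop atTop →
        ∀ᵐ ω ∂(Measure.infinitePi fun _ : ℤ => ν),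
          (∀ k, CMV.discriminantZeros ω (l k) (r k) ⊆ Metric.sphere (0 : ℂ) 1) ∧
          Tendsto (fun k => Metric.hausdorffEDist (CMV.discriminantZeros ω (l k) (r k)) S)
            atTop (𝓝 0) := by
  have hae := CMV.ae_spectrum_eq ν
  obtain ⟨ω₀, hω₀⟩ := hae.exists
  refine ⟨CMV.approxSpectrum ν.support, ?_, ?_, hae, fun l r hl hr => ?_⟩
  · rw [← hω₀]
    exact spectrum.isClosed _
  · rw [← hω₀]
    exact CMV.spectrum_extendedCMV_subset ω₀
  · filter_upwards [hae, CMV.ae_mem_support ν] with ω h1 h2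
    exact ⟨fun k z hz => mem_sphere_zero_iff_norm.2 (CMV.norm_eq_one_of_discriminant_eq_zero ω hz),
      CMV.tendsto_hausdorffEDist_discriminantZeros h2 h1 hl hr⟩
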